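/- Theorem 1.4. Let $2\le m<n$ be integers, let $\mathcal D\subset\{0,1,\dots,n-1\}\times\{0,1,\dots,m-1\}$ be a digit set with $\#\mathcal D>1$, and let $E=K(n,m,\mathcal D)\subset\mathbb R^2$ be the associated self-affine (Bedford–McMullen) carpet, that is, the unique non-empty compact set satisfying $E=\bigcup_{d\in\mathcal D}S_d(E)$, where $S_d(z)=\mathrm{diag}(n^{-1},m^{-1})(z+d)$. For $0\le j\le m-1$ put $a_j=\#\{i:(i,j)\in\mathcal D\}$. Assume that - $E$ is totally disconnected; - $\mathcal D$ has a vacant row: $a_j=0$ for some $j$; - $E$ has uniform horizontal fibers: all non-zero $a_j$ are equal. Let $\mathcal D^\infty$ be the set of infinite sequences of elements of $\mathcal D$. Write such a sequence as $(\mathbf x,\mathbf y)$, where $\mathbf x$ and $\mathbf y$ are the sequences of first and of second coordinates. Equip $\mathcal D^\infty$ with the metric $$\lambda\big((\mathbf x,\mathbf y),(\mathbf x',\mathbf y')\big)=\max\{d_{1/n}(\mathbf x,\mathbf x'),\,d_{1/m}(\mathbf y,\mathbf y')\},\qquad d_\xi(\mathbf u,\mathbf u')=\xi^{|\mathbf u\wedge\mathbf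 u'|},$$ where $|\mathbf u\wedge\mathbf u'|$ is the length of the maximal common prefix of $\mathbf u$ and $\mathbf u'$ (and $d_\xi(\mathbf u,\mathbf u)=0$). Then $E$, with the Euclidean metric, and $(\mathcal D^\infty,\lambda)$ are Lipschitz equivalent: there are a map $f$ of $E$ onto $\mathcal D^\infty$ and a constant $C>0$ such that $$C^{-1}|z-z'|\le\lambda(f(z),f(z'))\le C|z-z'|\qquad\text{for all }z,z'\in E.$$ -/

import Mathlib

namespace Carpet

/-- The plane with its Euclidean distance. -/
abbrev Plane : Type := EuclideanSpace ℝ (Fin 2)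

/-- The affine contraction `S_d(z) = diag(1/n, 1/m) (z + d)` attached to the digit `d`. -/
noncomputable def digitMap {n m : ℕ} (d : Fin n × Fin m) (z : Plane) : Plane :=
  !₂[(z 0 + ((d.1 : ℕ) : ℝ)) / (n : ℝ), (z 1 + ((d.2 : ℕ) : ℝ)) / (m : ℝ)]

/-- `E` is the self-affine carpet `K(n, m, D)`: a non-empty compact set such that
`E = ⋃_{d ∈ D} S_d(E)`. By `existsUnique_isCarpet` below there is exactly one such set. -/
structure IsCarpet {n m : ℕ} (D : Finset (Fin n × Fin m)) (E : Set Plane) : Prop where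
  nonempty : E.Nonempty
  isCompact : IsCompact E
  eq_iUnion : E = ⋃ d ∈ D, digitMap d '' E

/-- `a_j`, the number of digits of `D` in the `j`-th row. -/
def rowCount {n m : ℕ} (D : Finset (Fin n × Fin m)) (j : Fin m) : ℕ :=
  (Finset.univ.filter fun i : Fin n => (i, j) ∈ D).card

/-- Some row contains no digit. -/
def HasVacantRow {n m : ℕ} (D : Finset (Fin n × Fin m)) : Prop :=
  ∃ j : Fin m, rowCount D j = 0

/-- All non-zero `a_j` are equal. -/
def HasUniformFibers {n m : ℕ} (D : Finset (Fin n × Fin m)) : Prop :=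
  ∀ i j : Fin m, rowCount D i ≠ 0 → rowCount D j ≠ 0 → rowCount D i = rowCount D j

open Classical in
/-- `d_ξ(x, x') = ξ ^ |x ∧ x'|`, where `|x ∧ x'|` is the length of the maximal common prefix of
the two sequences (the first index, counted from `0`, at which they differ);
it is `0` if `x = x'`. -/
noncomputable def prefixDist {α : Type*} (ξ : ℝ) (x x' : ℕ → α) : ℝ :=
  if x = x' then 0 else ξ ^ PiNat.firstDiff x x'

/-- The space `D^∞` of infinite sequences of digits. -/
def DigitSpace {n m : ℕ} (D : Finset (Fin n × Fin m)) : Type := ℕ → D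

namespace DigitSpace

variable {n m : ℕ} {D : Finset (Fin n × Fin m)}

/-- The sequence `x` of first coordinates of a sequence `(x, y)` of digits. -/
def fstSeq (w : DigitSpace D) : ℕ → Fin n := fun k => (w k).1.1

/-- The sequence `y` of second coordinates of a sequence `(x, y)` of digits. -/
def sndSeq (w : DigitSpace D) : ℕ → Fin m := fun k => (w k).1.2

end DigitSpace

/-- `λ((x, y), (x', y')) = max {d_{1/n}(x, x'), d_{1/m}(y, y')}`. -/
noncomputable def lam {n m : ℕ} {D : Finset (Fin n × Fin m)} (w w' : DigitSpace D) : ℝ :=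
  max (prefixDist (1 / (n : ℝ)) w.fstSeq w'.fstSeq) (prefixDist (1 / (m : ℝ)) w.sndSeq w'.sndSeq)

theorem prefixDist_self {α : Type*} (ξ : ℝ) (x : ℕ → α) : prefixDist ξ x x = 0 := by
  simp [prefixDist]

theorem prefixDist_comm {α : Type*} (ξ : ℝ) (x y : ℕ → α) :
    prefixDist ξ x y = prefixDist ξ y x := by
  unfold prefixDist
  rw [PiNat.firstDiff_comm x y]
  by_cases h : x = y
  · rw [if_pos h, if_pos h.symm]
  · rw [if_neg h, if_neg (Ne.symm h)]

theorem prefixDist_nonneg {α : Type*} {ξ : ℝ} (h : 0 ≤ ξ) (x y : ℕ → α) :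
    0 ≤ prefixDist ξ x y := by
  unfold prefixDist
  split_ifs
  · exact le_rfl
  · positivity

theorem prefixDist_triangle {α : Type*} {ξ : ℝ} (h0 : 0 ≤ ξ) (h1 : ξ ≤ 1) (x y z : ℕ → α) :
    prefixDist ξ x z ≤ prefixDist ξ x y + prefixDist ξ y z := by
  have hxy := prefixDist_nonneg h0 x y
  have hyz := prefixDist_nonneg h0 y z
  by_cases hx : x = y
  · subst hx; linarith
  by_cases hy : y = z
  · subst hy; linarith
  by_cases hz : x = z
  · subst hz; rw [prefixDist_self]; linarith
  have hmin := PiNat.min_firstDiff_le x y z hz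
  have h : prefixDist ξ x z ≤ max (prefixDist ξ x y) (prefixDist ξ y z) := by
    simp only [prefixDist, hx, hy, hz, if_false]
    rcases min_le_iff.1 hmin with h | h
    · exact le_max_of_le_left (pow_le_pow_of_le_one h0 h1 h)
    · exact le_max_of_le_right (pow_le_pow_of_le_one h0 h1 h)
  rcases le_max_iff.1 h with h | h <;> linarith

theorem eq_of_prefixDist_eq_zero {α : Type*} {ξ : ℝ} (h0 : 0 < ξ) {x y : ℕ → α}
    (h : prefixDist ξ x y = 0) : x = y := by
  by_contra hne
  simp only [prefixDist, hne, if_false] at h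
  exact (pow_pos h0 _).ne' h

theorem one_div_natCast_le_one (k : ℕ) : 1 / (k : ℝ) ≤ 1 := by
  rw [one_div]; exact Nat.cast_inv_le_one k

/-- The distance of `D^∞` is `λ`. -/
noncomputable instance instMetricSpaceDigitSpace {n m : ℕ} (D : Finset (Fin n × Fin m)) : MetricSpace (DigitSpace D) where
  dist := lam
  dist_self w := by simp [lam, prefixDist_self]
  dist_comm w w' := by
    simp only [lam, prefixDist_comm _ w.fstSeq w'.fstSeq, prefixDist_comm _ w.sndSeq w'.sndSeq]
  dist_triangle u v w :=
    max_le
      ((prefixDist_triangle (by positivity) (one_div_natCast_le_one n) _ v.fstSeq _).trans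
        (add_le_add (le_max_left _ _) (le_max_left _ _)))
      ((prefixDist_triangle (by positivity) (one_div_natCast_le_one m) _ v.sndSeq _).trans
        (add_le_add (le_max_right _ _) (le_max_right _ _)))
  eq_of_dist_eq_zero := by
    intro u v h
    have hn : 0 < 1 / (n : ℝ) := one_div_pos.2 (Nat.cast_pos.2 (Fin.pos (u 0).1.1))
    have hm : 0 < 1 / (m : ℝ) := one_div_pos.2 (Nat.cast_pos.2 (Fin.pos (u 0).1.2))
    have h1 := prefixDist_nonneg hn.le u.fstSeq v.fstSeq
    have h2 := prefixDist_nonneg hm.le u.sndSeq v.sndSeq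
    have h' : max (prefixDist (1 / (n : ℝ)) u.fstSeq v.fstSeq)
      (prefixDist (1 / (m : ℝ)) u.sndSeq v.sndSeq) = 0 := h
    have e1 := eq_of_prefixDist_eq_zero hn (le_antisymm ((le_max_left _ _).trans h'.le) h1)
    have e2 := eq_of_prefixDist_eq_zero hm (le_antisymm ((le_max_right _ _).trans h'.le) h2)
    funext k
    exact Subtype.ext (Prod.ext (congrFun e1 k) (congrFun e2 k))

/-- Lipschitz equivalence `X ∼ Y`: there is a bi-Lipschitz map of `X` onto `Y`. -/
def LipschitzEquivalent (X Y : Type*) [MetricSpace X] [MetricSpace Y] : Prop :=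
  ∃ f : X → Y, Function.Surjective f ∧ ∃ C : ℝ, 0 < C ∧
    ∀ x x' : X, C⁻¹ * dist x x' ≤ dist (f x) (f x') ∧ dist (f x) (f x') ≤ C * dist x x'

/-! Existence and uniqueness of the carpet. -/

theorem dist_digitMap_le {n m : ℕ} (hn : 2 ≤ n) (hm : 2 ≤ m) (d : Fin n × Fin m) (z w : Plane) :
    dist (digitMap d z) (digitMap d w) ≤ (1 / 2) * dist z w := by
  have hn' : (2 : ℝ) ≤ n := by exact_mod_cast hn
  have hm' : (2 : ℝ) ≤ m := by exact_mod_cast hm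
  have key : ∀ (q a b c : ℝ), 2 ≤ q → ((a + c) / q - (b + c) / q) ^ 2 ≤ (1 / 4) * (a - b) ^ 2 := by
    intro q a b c hq
    have e : ((a + c) / q - (b + c) / q) ^ 2 = (1 / q ^ 2) * (a - b) ^ 2 := by
      have : q ≠ 0 := by linarith
      field_simp
      ring
    rw [e]
    have : 1 / q ^ 2 ≤ 1 / 4 := one_div_le_one_div_of_le (by norm_num) (by nlinarith)
    exact mul_le_mul_of_nonneg_right this (sq_nonneg _)
  rw [EuclideanSpace.dist_eq, EuclideanSpace.dist_eq, Fin.sum_univ_two, Fin.sum_univ_two]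
  refine Real.sqrt_le_iff.2 ⟨by positivity, ?_⟩
  rw [mul_pow, Real.sq_sqrt (by positivity)]
  simp only [Real.dist_eq, sq_abs, digitMap]
  have h0 := key n (z 0) (w 0) ((d.1 : ℕ) : ℝ) hn'
  have h1 := key m (z 1) (w 1) ((d.2 : ℕ) : ℝ) hm'
  simp only [Matrix.cons_val_zero, Matrix.cons_val_one]
  linarith

theorem lipschitzWith_digitMap {n m : ℕ} (hn : 2 ≤ n) (hm : 2 ≤ m) (d : Fin n × Fin m) :
    LipschitzWith (1 / 2) (digitMap d) :=
  LipschitzWith.of_dist_le_mul fun z w => by simpa using dist_digitMap_le hn hm d z w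

open TopologicalSpace in
theorem existsUnique_isCarpet {n m : ℕ} (hm : 2 ≤ m) (hmn : m < n) (D : Finset (Fin n × Fin m))
    (hD : D.Nonempty) : ∃! E : Set Plane, IsCarpet D E := by
  have hn : 2 ≤ n := by omega
  have hL := lipschitzWith_digitMap (n := n) (m := m) hn hm
  let F : NonemptyCompacts Plane → NonemptyCompacts Plane := fun K =>
    ⟨⟨⋃ d ∈ D, digitMap d '' (K : Set Plane),
      D.isCompact_biUnion fun d _ => K.isCompact.image (hL d).continuous⟩, by
      obtain ⟨d, hd⟩ := hD
      obtain ⟨z, hz⟩ := K.nonempty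
      exact ⟨digitMap d z, Set.mem_biUnion hd ⟨z, hz, rfl⟩⟩⟩
  have hF : ∀ K, (F K : Set Plane) = ⋃ d ∈ D, digitMap d '' (K : Set Plane) := fun _ => rfl
  have half : ∀ A B : NonemptyCompacts Plane, ∀ x ∈ (F A : Set Plane), ∃ y ∈ (F B : Set Plane),
      edist x y ≤ ((1 / 2 : NNReal) : ENNReal) * edist A B := by
    intro A B x hx
    rw [hF] at hx
    obtain ⟨d, hd, a, ha, rfl⟩ : ∃ d ∈ D, ∃ a ∈ (A : Set Plane), digitMap d a = x := by
      simpa using hx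
    obtain ⟨b, hb, hab⟩ := B.isCompact.exists_infEDist_eq_edist B.nonempty a
    refine ⟨digitMap d b, Set.mem_biUnion hd ⟨b, hb, rfl⟩, (hL d a b).trans ?_⟩
    rw [← hab]
    exact mul_le_mul_right (Metric.infEDist_le_hausdorffEDist_of_mem ha) _
  have hc : ContractingWith (1 / 2) F := by
    refine ⟨by rw [← NNReal.coe_lt_coe]; norm_num, fun A B => ?_⟩
    refine Metric.hausdorffEDist_le_of_mem_edist (half A B) ?_
    rw [edist_comm A B]
    exact half B A
  have : Nonempty (NonemptyCompacts Plane) := ⟨⟨⟨{0}, isCompact_singleton⟩, ⟨0, rfl⟩⟩⟩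
  refine ⟨((hc.fixedPoint F : NonemptyCompacts Plane) : Set Plane), ?_, fun E hE => ?_⟩
  · refine ⟨(hc.fixedPoint F).nonempty, (hc.fixedPoint F).isCompact, ?_⟩
    rw [← hF, hc.fixedPoint_isFixedPt]
  · let K : NonemptyCompacts Plane := ⟨⟨E, hE.isCompact⟩, hE.nonempty⟩
    have hK : Function.IsFixedPt F K := SetLike.coe_injective hE.eq_iUnion.symm
    exact congrArg (fun K : NonemptyCompacts Plane => (K : Set Plane)) (hc.fixedPoint_unique hK)

end Carpet

/-!
Let `A t` be the set of abscissae of the digits in row `t` and `Y` the set of heights of the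
non-empty rows. A carpet that contains no segment has no full row, so the common cardinality `a` of
the non-empty rows satisfies `0 < a < n`, and `Y` is a proper subset of the `m` possible heights.

**Cells and clusters.** Cut the plane into rectangles of width `n ^ (-k)` and height `m ^ (-L)`,
where `m ^ L` is comparable to `n ^ k`. The cells that occur in the coding correspond, up to
bounded factors, to the balls of radius `n ^ (-k)` of the symbolic space, and each has the same
number `M` of children at the next level. In the carpet neighbouring cells may touch, so they are
grouped into clusters: the heights must lie in the same run of consecutive admissible integers, and
the abscissae in the same run of the union of the rows over this run of heights. Distinct clusters
are separated by a distance comparable to `n ^ (-k)`, and clusters have bounded size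
(`RowSystem.card_cluster_le`): a run of heights misses a residue modulo `m`, hence meets at most
two different rows, and two rows cannot fill a long interval since `2 * a ^ q < n ^ q` for some
`q`.

**Rearrangement.** The symbolic space is a homogeneous tree, the clusters of the carpet form a tree
which is not. The two are compared by redistributing, inside each cluster `V` of level `k`, the
clusters of level `k + r` below `V` over the cells of `V`: every cell has to receive exactly `M`
cells, and no cluster may be split (`RowSystem.exists_cell_binning`). This is a packing problem
with items of bounded size and large bins, solved by `exists_packing` as soon as every common
divisor `g` of the sizes that occur often below `V` divides the size of each item and `M`. This
divisibility comes from the product structure inside a block of side one digit. For each run `I` of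
a row `A t` below `V` and each run `J` of `Y`, the product `I × J` is, up to translation, a cluster
that occurs often (`RowSystem.exists_product_clusters`), because the digits before can be chosen to
isolate it from its neighbours. So `g` divides all products `|I| * |J|`. An arbitrary cluster meets
each block in a product of a union of such `I` with a union of such `J`, so `g` divides its size
(`RowSystem.dvd_card_cluster`); also `g` divides `a * |Y|`, which divides `M`. Uniform fibres enter
here: they make `M` the same for all cells.

**The map.** As the redistribution keeps the cells of each level equinumerous, it is conjugate to
the parent map of the homogeneous tree (`exists_level_equivs`). Following a point of the carpet
through the levels thus gives a compatible sequence of cells, that is, a sequence of digits.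
Points in the same cluster of level `i + 1` have images in the same cell of level `i`, and points in
different clusters of level `i` have images in different cells of level `i`, so that the map is
bi-Lipschitz; its image is compact and meets every cell.
-/

namespace Carpet

open Set

/-! ### Integers with prescribed digits -/

/-- The integers with `k` digits in base `b` (leading digit first) whose `p`-th digit lies in
`A p`. -/
def digitSet (b : ℕ) (A : ℕ → Finset ℕ) : ℕ → Set ℕ
  | 0 => {0}
  | k + 1 => {x | x / b ∈ digitSet b A k ∧ x % b ∈ A k}

theorem mem_digitSet_succ {b : ℕ} {A : ℕ → Finset ℕ} {k x : ℕ} :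
    x ∈ digitSet b A (k + 1) ↔ x / b ∈ digitSet b A k ∧ x % b ∈ A k := Iff.rfl

theorem lt_of_mem_digitSet {b : ℕ} (hb : 0 < b) {A : ℕ → Finset ℕ} {k : ℕ} :
    ∀ {x : ℕ}, x ∈ digitSet b A k → x < b ^ k := by
  induction k with
  | zero => intro x hx; have : x = 0 := hx; simp [this]
  | succ k ih =>
    intro x hx
    have := ih hx.1
    rwa [Nat.div_lt_iff_lt_mul hb, ← pow_succ] at this

theorem digitSet_congr {b : ℕ} {A A' : ℕ → Finset ℕ} {k : ℕ} (h : ∀ p < k, A p = A' p) :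
    digitSet b A k = digitSet b A' k := by
  induction k with
  | zero => rfl
  | succ k ih =>
    ext x
    rw [mem_digitSet_succ, mem_digitSet_succ, ih fun p hp => h p (by omega), h k (by omega)]

theorem div_pow_mem_digitSet {b : ℕ} {A : ℕ → Finset ℕ} {k : ℕ} (q : ℕ) :
    ∀ {x : ℕ}, x ∈ digitSet b A (k + q) → x / b ^ q ∈ digitSet b A k := by
  induction q with
  | zero => intro x hx; simpa using hx
  | succ q ih =>
    intro x hx
    have := ih (mem_digitSet_succ.1 hx).1
    rwa [Nat.div_div_eq_div_mul, ← pow_succ'] at this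

theorem mul_add_div_of_lt {b i : ℕ} (h : i < b) (c : ℕ) : (b * c + i) / b = c := by
  rw [Nat.mul_add_div (by omega), Nat.div_eq_of_lt h, add_zero]

theorem mul_add_mod_of_lt {b i : ℕ} (h : i < b) (c : ℕ) : (b * c + i) % b = i := by
  rw [Nat.mul_add_mod, Nat.mod_eq_of_lt h]

/-- Every block of a digit set is as large as the number of choices of its remaining digits. -/
theorem exists_finset_block {b a : ℕ} {A : ℕ → Finset ℕ} (hA : ∀ p, A p ⊆ Finset.range b)
    (ha : ∀ p, (A p).card = a) {k c : ℕ} (hc : c ∈ digitSet b A k) (q : ℕ) :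
    ∃ S : Finset ℕ, S.card = a ^ q ∧
      ∀ x, x ∈ S ↔ x ∈ digitSet b A (k + q) ∧ x / b ^ q = c := by
  induction q with
  | zero =>
    refine ⟨{c}, by simp, fun x => ?_⟩
    simp only [Finset.mem_singleton, add_zero, pow_zero, Nat.div_one]
    exact ⟨fun h => ⟨h ▸ hc, h⟩, fun h => h.2⟩
  | succ q ih =>
    obtain ⟨S, hS, hmem⟩ := ih
    have hlt : ∀ {p i}, i ∈ A p → i < b := fun h => Finset.mem_range.1 (hA _ h)
    refine ⟨(S ×ˢ A (k + q)).image fun y => b * y.1 + y.2, ?_, fun x => ?_⟩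
    · rw [Finset.card_image_of_injOn, Finset.card_product, hS, ha, pow_succ]
      rintro ⟨y, i⟩ hy ⟨y', i'⟩ hy' h
      simp only [Finset.coe_product, Set.mem_prod, Finset.mem_coe] at hy hy' h
      have h1 := congrArg (· / b) h
      have h2 := congrArg (· % b) h
      simp only [mul_add_div_of_lt (hlt hy.2), mul_add_div_of_lt (hlt hy'.2),
        mul_add_mod_of_lt (hlt hy.2), mul_add_mod_of_lt (hlt hy'.2)] at h1 h2
      rw [h1, h2]
    · simp only [Finset.mem_image, Finset.mem_product, Prod.exists]
      rw [← add_assoc, mem_digitSet_succ, pow_succ', ← Nat.div_div_eq_div_mul]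
      constructor
      · rintro ⟨y, i, ⟨hy, hi⟩, rfl⟩
        rw [mul_add_div_of_lt (hlt hi), mul_add_mod_of_lt (hlt hi)]
        exact ⟨⟨((hmem y).1 hy).1, hi⟩, ((hmem y).1 hy).2⟩
      · rintro ⟨⟨h1, h2⟩, h3⟩
        exact ⟨x / b, x % b, ⟨(hmem _).2 ⟨h1, h3⟩, h2⟩, Nat.div_add_mod x b⟩

/-! ### Runs of consecutive integers -/

theorem uIcc_subset_trans {S : Set ℕ} {u v w : ℕ} (h₁ : uIcc u v ⊆ S) (h₂ : uIcc v w ⊆ S) :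
    uIcc u w ⊆ S :=
  uIcc_subset_uIcc_union_uIcc.trans (union_subset h₁ h₂)

theorem uIcc_subset_symm {S : Set ℕ} {u v : ℕ} (h : uIcc u v ⊆ S) : uIcc v u ⊆ S := by
  rwa [uIcc_comm]

theorem uIcc_self_subset {S : Set ℕ} {u : ℕ} (h : u ∈ S) : uIcc u u ⊆ S := by
  rwa [uIcc_self, singleton_subset_iff]

theorem uIcc_subset_of_close {S : Set ℕ} {u v : ℕ} (hu : u ∈ S) (hv : v ∈ S) (h₁ : u ≤ v + 1)
    (h₂ : v ≤ u + 1) : uIcc u v ⊆ S := by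
  intro x hx
  rw [mem_uIcc] at hx
  obtain rfl | rfl : x = u ∨ x = v := by omega
  exacts [hu, hv]

theorem exists_mem_uIcc_div_eq {d u v c : ℕ} (hd : 0 < d) (hc : c ∈ uIcc (u / d) (v / d)) :
    ∃ x ∈ uIcc u v, x / d = c := by
  wlog huv : u ≤ v generalizing u v
  · rw [uIcc_comm] at hc ⊢
    exact this hc (by omega)
  rw [uIcc_of_le (Nat.div_le_div_right huv)] at hc
  rw [uIcc_of_le huv]
  have h1 : c * d ≤ v := (Nat.le_div_iff_mul_le hd).1 hc.2
  rcases le_total u (c * d) with h | h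
  · exact ⟨c * d, ⟨h, h1⟩, Nat.mul_div_cancel _ hd⟩
  · exact ⟨u, ⟨le_rfl, huv⟩, le_antisymm hc.1 ((Nat.le_div_iff_mul_le hd).2 h)⟩

/-- A residue missing from `S` bounds the length of the runs of `S`. -/
theorem lt_add_of_uIcc_subset {S : Set ℕ} {m r u v : ℕ} (hr : r < m)
    (hS : ∀ x ∈ S, x % m ≠ r) (h : uIcc u v ⊆ S) : v < u + m := by
  by_contra! hv
  rw [uIcc_of_le (by omega)] at h
  have hu := Nat.div_add_mod u m
  have hum := Nat.mod_lt u (show 0 < m by omega)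
  by_cases hur : u % m ≤ r
  · exact hS (m * (u / m) + r) (h ⟨by omega, by omega⟩) (mul_add_mod_of_lt hr _)
  · refine hS (m * (u / m + 1) + r) (h ?_) (mul_add_mod_of_lt hr _)
    rw [mul_add, mem_Icc]
    omega

theorem div_le_div_add_one {m u v : ℕ} (hm : 0 < m) (h : u ≤ v + m) : u / m ≤ v / m + 1 := by
  rw [← Nat.add_div_right _ hm]
  exact Nat.div_le_div_right h

/-- The run of `i` in a finite set of integers. -/
noncomputable def component (A : Finset ℕ) (i : ℕ) : Finset ℕ := by
  classical exact A.filter fun j => uIcc i j ⊆ (A : Set ℕ)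

theorem mem_component {A : Finset ℕ} {i j : ℕ} :
    j ∈ component A i ↔ j ∈ A ∧ uIcc i j ⊆ (A : Set ℕ) := by
  simp [component]

theorem mem_component' {A : Finset ℕ} {i j : ℕ} : j ∈ component A i ↔ uIcc i j ⊆ (A : Set ℕ) :=
  mem_component.trans ⟨fun h => h.2, fun h => ⟨h right_mem_uIcc, h⟩⟩

/-- A set that contains every run of `A` it meets is a disjoint union of such runs. -/
theorem dvd_card_mul_of_saturated {A T : Finset ℕ} {g c : ℕ} (hTA : T ⊆ A)
    (hT : ∀ i ∈ T, ∀ j, uIcc i j ⊆ (A : Set ℕ) → j ∈ T)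
    (h : ∀ i ∈ A, g ∣ (component A i).card * c) : g ∣ T.card * c := by
  classical
  rw [Finset.card_eq_sum_card_fiberwise (f := component A) (t := T.image (component A))
    (fun i hi => Finset.mem_coe.2 (Finset.mem_image_of_mem _ hi)), Finset.sum_mul]
  refine Finset.dvd_sum fun C hC => ?_
  obtain ⟨i, hi, rfl⟩ := Finset.mem_image.1 hC
  suffices hC : T.filter (fun j => component A j = component A i) = component A i by
    rw [hC]; exact h i (hTA hi)
  ext j
  rw [Finset.mem_filter, mem_component']
  constructor
  · rintro ⟨hj, he⟩
    rw [← mem_component', ← he, mem_component']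
    exact uIcc_self_subset (hTA hj)
  · intro hj
    refine ⟨hT i hi j hj, ?_⟩
    ext l
    rw [mem_component', mem_component']
    exact ⟨uIcc_subset_trans hj, uIcc_subset_trans (uIcc_subset_symm hj)⟩

/-- If a missing digit `r` closes a block on one side and the neighbouring block on the other side
is absent, then a run of integers with last digit in `A` stays inside its block. -/
theorem uIcc_subset_iff_of_barrier {b : ℕ} {P : Set ℕ} {A : Finset ℕ} {c i₀ r : ℕ}
    (hA : A ⊆ Finset.range b) (hc : c ∈ P) (hi : i₀ ∈ A) (hrb : r < b) (hr : r ∉ A)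
    (h : (r < i₀ ∧ c + 1 ∉ P) ∨ (i₀ < r ∧ ∀ p, p + 1 = c → p ∉ P)) (x : ℕ) :
    uIcc (b * c + i₀) x ⊆ {x | x / b ∈ P ∧ x % b ∈ A} ↔
      x / b = c ∧ uIcc i₀ (x % b) ⊆ (A : Set ℕ) := by
  have hib : i₀ < b := Finset.mem_range.1 (hA hi)
  have hx := Nat.div_add_mod x b
  have hxm := Nat.mod_lt x (show 0 < b by omega)
  constructor
  · intro hs
    have hcx : x / b = c := by
      rcases lt_trichotomy (x / b) c with hlt | heq | hgt
      · exfalso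
        obtain ⟨p, rfl⟩ : ∃ p, c = p + 1 := Nat.exists_eq_succ_of_ne_zero (Nat.ne_zero_of_lt hlt)
        have hle : b * (x / b) ≤ b * p := Nat.mul_le_mul_left _ (Nat.lt_succ_iff.1 hlt)
        rcases h with ⟨h1, _⟩ | ⟨_, h2⟩
        · have := (hs (show b * (p + 1) + r ∈ _ by rw [mem_uIcc, mul_add]; omega)).2
          rw [mul_add_mod_of_lt hrb] at this
          exact hr this
        · have := (hs (show b * p + (b - 1) ∈ _ by rw [mem_uIcc, mul_add]; omega)).1
          rw [mul_add_div_of_lt (by omega)] at this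
          exact h2 p rfl this
      · exact heq
      · exfalso
        have hle : b * (c + 1) ≤ b * (x / b) := Nat.mul_le_mul_left _ hgt
        rw [mul_add, mul_one] at hle
        rcases h with ⟨_, h2⟩ | ⟨h1, _⟩
        · have := (hs (show b * (c + 1) + 0 ∈ _ by rw [mem_uIcc, mul_add]; omega)).1
          rw [mul_add_div_of_lt (by omega)] at this
          exact h2 this
        · have := (hs (show b * c + r ∈ _ by rw [mem_uIcc]; omega)).2
          rw [mul_add_mod_of_lt hrb] at this
          exact hr this
    refine ⟨hcx, fun l hl => ?_⟩
    rw [mem_uIcc] at hl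
    have := (hs (show b * c + l ∈ _ by rw [mem_uIcc, ← hx, hcx]; omega)).2
    rwa [mul_add_mod_of_lt (by omega)] at this
  · rintro ⟨rfl, hs⟩ y hy
    generalize x / b = c at *
    rw [mem_uIcc] at hy
    obtain ⟨l, rfl⟩ : ∃ l, y = b * c + l := ⟨y - b * c, by omega⟩
    have hl : l ∈ uIcc i₀ (x % b) := by rw [mem_uIcc]; omega
    have hlb : l < b := by rw [mem_uIcc] at hl; omega
    exact ⟨by rwa [mul_add_div_of_lt hlb], by rw [mul_add_mod_of_lt hlb]; exact hs hl⟩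

/-- Going around `ℤ/b`, a non-trivial set of residues has an exit. -/
theorem exists_last_residue {b : ℕ} {Q : ℕ → Prop} (h₁ : ∃ e < b, Q e) (h₀ : ∃ r < b, ¬ Q r) :
    ∃ e < b, Q e ∧ ¬ Q ((e + 1) % b) := by
  by_contra! H
  obtain ⟨e, he, hQ⟩ := h₁
  obtain ⟨r, hr, hQr⟩ := h₀
  have hall : ∀ j, Q ((e + j) % b) := by
    intro j
    induction j with
    | zero => rwa [add_zero, Nat.mod_eq_of_lt he]
    | succ j ih =>
      have := H _ (Nat.mod_lt _ (by omega)) ih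
      rwa [Nat.mod_add_mod, add_assoc] at this
  apply hQr
  have := hall (b - e + r)
  rwa [show e + (b - e + r) = r + b by omega, Nat.add_mod_right, Nat.mod_eq_of_lt hr] at this

/-- In a digit set one can fix the last digit of `c = b * y + e`, independently of `y`, so that
runs starting in the block over `c` at a given digit do not leave this block. -/
theorem exists_isolating_digit {b : ℕ} {A A' : Finset ℕ} (hA : A ⊆ Finset.range b)
    (hA' : A' ⊆ Finset.range b) (hcA : A.card < b) (hcA' : A'.card < b) (hne : A'.Nonempty)
    {i₀ : ℕ} (hi : i₀ ∈ A) :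
    ∃ e ∈ A', ∀ P : Set ℕ, ∀ y ∈ P, ∀ x,
      (uIcc (b * (b * y + e) + i₀) x ⊆
          {x | x / b ∈ {z | z / b ∈ P ∧ z % b ∈ A'} ∧ x % b ∈ A} ↔
        x / b = b * y + e ∧ uIcc i₀ (x % b) ⊆ (A : Set ℕ)) := by
  have hgap : ∀ B : Finset ℕ, B.card < b → ∃ r < b, r ∉ B := by
    intro B hB
    obtain ⟨r, hr, hrB⟩ := Finset.exists_mem_notMem_of_card_lt_card
      (show B.card < (Finset.range b).card by simpa using hB)
    exact ⟨r, Finset.mem_range.1 hr, hrB⟩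
  have hlt : ∀ {i}, i ∈ A' → i < b := fun h => Finset.mem_range.1 (hA' h)
  obtain ⟨e₁, he₁⟩ := hne
  obtain ⟨r, hrb, hr⟩ := hgap A hcA
  rcases lt_or_gt_of_ne (show r ≠ i₀ by rintro rfl; exact hr hi) with hri | hri
  · obtain ⟨e, -, heA, he'⟩ := exists_last_residue (Q := (· ∈ A')) ⟨e₁, hlt he₁, he₁⟩ (hgap A' hcA')
    refine ⟨e, heA, fun P y hy x => uIcc_subset_iff_of_barrier hA ?_ hi hrb hr (.inl ⟨hri, ?_⟩) x⟩
    · exact ⟨by rwa [mul_add_div_of_lt (hlt heA)], by rwa [mul_add_mod_of_lt (hlt heA)]⟩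
    · rintro ⟨-, h⟩
      rw [add_assoc, Nat.mul_add_mod] at h
      exact he' h
  · obtain ⟨f, hfb, hfA, hf⟩ := exists_last_residue (Q := (· ∉ A')) (hgap A' hcA')
      ⟨e₁, hlt he₁, not_not.2 he₁⟩
    rw [not_not] at hf
    refine ⟨(f + 1) % b, hf, fun P y hy x =>
      uIcc_subset_iff_of_barrier hA ?_ hi hrb hr (.inr ⟨hri, ?_⟩) x⟩
    · exact ⟨by rwa [mul_add_div_of_lt (hlt hf)], by rwa [mul_add_mod_of_lt (hlt hf)]⟩
    · rintro p hp ⟨-, h⟩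
      have h1 : (p + 1) % b = (f + 1) % b := by rw [hp, mul_add_mod_of_lt (hlt hf)]
      have h2 : p % b = f % b := Nat.ModEq.add_right_cancel' 1 h1
      rw [h2, Nat.mod_eq_of_lt hfb] at h
      exact hfA h

end Carpet

namespace Carpet

open Finset

/-! ### Exact packing of items into bins -/

theorem exists_subset_sum_near {ι : Type*} (w : ι → ℕ) {C : ℕ} (S : Finset ι)
    (hw : ∀ i ∈ S, w i ≤ C) {τ : ℕ} (hτ : τ ≤ ∑ i ∈ S, w i) :
    ∃ J ⊆ S, ∑ i ∈ J, w i ≤ τ ∧ τ ≤ ∑ i ∈ J, w i + C := by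
  classical
  induction S using Finset.induction_on with
  | empty => exact ⟨∅, subset_rfl, by simp, by simp at hτ ⊢; omega⟩
  | insert i S hi ih =>
    by_cases h : τ ≤ ∑ i ∈ S, w i
    · obtain ⟨J, hJ, h1⟩ := ih (fun i hi => hw i (mem_insert_of_mem hi)) h
      exact ⟨J, hJ.trans (subset_insert _ _), h1⟩
    · rw [sum_insert hi] at hτ
      have := hw i (mem_insert_self _ _)
      exact ⟨S, subset_insert _ _, by omega, by omega⟩

theorem exists_subset_sum_eq_multiset_sum {ι : Type*} (w : ι → ℕ) {K : ℕ} (R : Finset ι)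
    (l : Multiset ℕ) (hl : ∀ z ∈ l, K ≤ #{i ∈ R | w i = z}) (hK : l.card ≤ K) :
    ∃ J ⊆ R, #J = l.card ∧ ∑ i ∈ J, w i = l.sum := by
  classical
  induction l using Multiset.induction_on with
  | empty => exact ⟨∅, empty_subset _, by simp, by simp⟩
  | cons z l ih =>
    rw [Multiset.card_cons] at hK
    obtain ⟨J, hJ, hc, hs⟩ := ih (fun z hz => hl z (Multiset.mem_cons_of_mem hz)) (by omega)
    obtain ⟨i, hi, hiJ⟩ := exists_mem_notMem_of_card_lt_card
      (show #J < #{i ∈ R | w i = z} by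
        have := hl z (Multiset.mem_cons_self _ _); omega)
    rw [mem_filter] at hi
    refine ⟨insert i J, insert_subset hi.1 hJ, ?_, ?_⟩
    · rw [card_insert_of_notMem hiJ, hc, Multiset.card_cons]
    · rw [sum_insert hiJ, hs, hi.2, Multiset.sum_cons]

/-- Bins are filled one after another: large items are put in greedily, and the remaining gap, a
large multiple of the greatest common divisor, is filled with items from the reserve `R`. The last
bin receives everything that is left. -/
theorem exists_packing_of_reserve {ι β : Type*} [DecidableEq β] (w : ι → ℕ) {C F M g : ℕ}
    {Z : Finset ℕ}
    (hZ : ∀ z ∈ Z, 0 < z) (hF : ∀ x ≥ F, g ∣ x → x ∈ AddSubmonoid.closure (Z : Set ℕ))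
    (hgM : g ∣ M) (hFM : F ≤ M) {B : Finset β} (hB : B.Nonempty) :
    ∀ I R : Finset ι, R ⊆ I → ∑ i ∈ R, w i ≤ M →
      (∀ z ∈ Z, #B * (F + C) ≤ #{i ∈ R | w i = z}) → (∀ i ∈ I, w i ≤ C) → (∀ i ∈ I, g ∣ w i) →
      ∑ i ∈ I, w i = #B * M →
      ∃ h : ι → β, (∀ i ∈ I, h i ∈ B) ∧ ∀ b ∈ B, ∑ i ∈ I with h i = b, w i = M := by
  classical
  induction hB using Finset.Nonempty.cons_induction with
  | singleton b =>
    intro I R _ _ _ _ _ hsum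
    refine ⟨fun _ => b, by simp, fun b' hb' => ?_⟩
    rw [mem_singleton] at hb'
    simpa [hb'] using hsum
  | cons b B hb hBne ih =>
    intro I R hRI hR hZR hC hg hsum
    rw [card_cons] at hZR hsum
    have hBpos : 1 ≤ #B := hBne.card_pos
    have hIR : ∑ i ∈ I \ R, w i + ∑ i ∈ R, w i = ∑ i ∈ I, w i := sum_sdiff hRI
    have hBM : M ≤ #B * M := Nat.le_mul_of_pos_left _ hBpos
    rw [add_mul, one_mul] at hsum
    obtain ⟨J₀, hJ₀, hle, hge⟩ := exists_subset_sum_near w (C := C) (I \ R)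
      (fun i hi => hC i (sdiff_subset hi)) (τ := M - F) (by omega)
    have hgJ₀ : g ∣ ∑ i ∈ J₀, w i := dvd_sum fun i hi => hg i (sdiff_subset (hJ₀ hi))
    obtain ⟨l, hlZ, hl⟩ := AddSubmonoid.exists_multiset_of_mem_closure
      (hF (M - ∑ i ∈ J₀, w i) (by omega) (Nat.dvd_sub hgM hgJ₀))
    have hcard : l.card ≤ F + C := by
      have : l.card • 1 ≤ l.sum := Multiset.card_nsmul_le_sum fun z hz => hZ z (hlZ z hz)
      rw [smul_eq_mul, mul_one] at this
      omega
    obtain ⟨J₁, hJ₁, hcJ₁, hsJ₁⟩ := exists_subset_sum_eq_multiset_sum w R l (K := F + C)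
      (fun z hz => le_trans (by rw [add_mul, one_mul]; omega) (hZR z (hlZ z hz))) hcard
    have hdisj : Disjoint J₀ J₁ :=
      disjoint_left.2 fun i h0 h1 => (mem_sdiff.1 (hJ₀ h0)).2 (hJ₁ h1)
    have hJI : J₀ ∪ J₁ ⊆ I := union_subset (hJ₀.trans sdiff_subset) (hJ₁.trans hRI)
    have hJsum : ∑ i ∈ J₀ ∪ J₁, w i = M := by
      rw [sum_union hdisj]; omega
    have hrest : ∑ i ∈ I \ (J₀ ∪ J₁), w i + ∑ i ∈ J₀ ∪ J₁, w i = ∑ i ∈ I, w i := sum_sdiff hJI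
    obtain ⟨h, hhB, hh⟩ := ih (I \ (J₀ ∪ J₁)) (R \ J₁)
      (fun i hi => by
        rw [mem_sdiff] at hi ⊢
        refine ⟨hRI hi.1, fun hJ => ?_⟩
        rcases mem_union.1 hJ with h0 | h1
        exacts [(mem_sdiff.1 (hJ₀ h0)).2 hi.1, hi.2 h1])
      (le_trans (sum_le_sum_of_subset sdiff_subset) hR)
      (fun z hz => by
        have h1 : #{i ∈ R | w i = z} ≤ #{i ∈ R \ J₁ | w i = z} + #J₁ := by
          refine le_trans (card_le_card fun i hi => ?_) (card_union_le _ _)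
          rw [mem_filter] at hi
          rw [mem_union, mem_filter, mem_sdiff]
          by_cases h : i ∈ J₁
          · exact .inr h
          · exact .inl ⟨⟨hi.1, h⟩, hi.2⟩
        have h2 := hZR z hz
        rw [add_mul, one_mul] at h2
        omega)
      (fun i hi => hC i (sdiff_subset hi)) (fun i hi => hg i (sdiff_subset hi)) (by omega)
    refine ⟨fun i => if i ∈ J₀ ∪ J₁ then b else h i, fun i hi => ?_, fun b' hb' => ?_⟩
    · dsimp only
      split_ifs with hiJ
      · exact mem_cons_self _ _
      · exact mem_cons_of_mem (hhB i (mem_sdiff.2 ⟨hi, hiJ⟩))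
    · rcases mem_cons.1 hb' with rfl | hb'
      · rw [← hJsum]
        refine sum_congr (ext fun i => ?_) fun _ _ => rfl
        simp only [mem_filter]
        constructor
        · rintro ⟨hi, hib⟩
          by_contra hiJ
          rw [if_neg hiJ] at hib
          exact hb (hib ▸ hhB i (mem_sdiff.2 ⟨hi, hiJ⟩))
        · exact fun hi => ⟨hJI hi, if_pos hi⟩
      · rw [← hh b' hb']
        refine sum_congr (ext fun i => ?_) fun _ _ => rfl
        simp only [mem_filter, mem_sdiff]
        constructor
        · rintro ⟨hi, hib⟩
          have hiJ : i ∉ J₀ ∪ J₁ := by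
            intro hiJ
            rw [if_pos hiJ] at hib
            exact hb (hib ▸ hb')
          rw [if_neg hiJ] at hib
          exact ⟨⟨hi, hiJ⟩, hib⟩
        · rintro ⟨⟨hi, hiJ⟩, hib⟩
          exact ⟨hi, by rw [if_neg hiJ, hib]⟩

theorem exists_frobenius_bound (C : ℕ) :
    ∃ F : ℕ, ∀ Z ⊆ range (C + 1), ∀ x ≥ F, Nat.setGcd (Z : Set ℕ) ∣ x →
      x ∈ AddSubmonoid.closure (Z : Set ℕ) := by
  choose f hf using fun Z : Finset ℕ => Nat.exists_mem_closure_of_ge (Z : Set ℕ)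
  exact ⟨(range (C + 1)).powerset.sup f, fun Z hZ x hx =>
    hf Z x (le_trans (le_sup (mem_powerset.2 hZ)) hx)⟩

/-- **Exact packing.** Items of size at most `C` can be distributed over at most `C` bins of equal
large capacity `M`, without waste, as soon as every common divisor of the sizes that occur often
divides the size of each item and the capacity. -/
theorem exists_packing (C : ℕ) : ∃ K : ℕ, ∀ {ι β : Type} [DecidableEq β] (w : ι → ℕ)
    (I : Finset ι) (B : Finset β) (M : ℕ), B.Nonempty → #B ≤ C → K ≤ M → (∀ i ∈ I, 0 < w i ∧ w i ≤ C) →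
    ∑ i ∈ I, w i = #B * M →
    (∀ g : ℕ, (∀ z, K ≤ #{i ∈ I | w i = z} → g ∣ z) → (∀ i ∈ I, g ∣ w i) ∧ g ∣ M) →
    ∃ h : ι → β, (∀ i ∈ I, h i ∈ B) ∧ ∀ b ∈ B, ∑ i ∈ I with h i = b, w i = M := by
  classical
  obtain ⟨F, hF⟩ := exists_frobenius_bound C
  -- `N` items of each frequent size are kept in reserve
  set N := C * (F + C) with hN
  refine ⟨N + F + 1 + (C + 1) * (N * C), fun {ι β} _ w I B M hB hBC hKM hw hsum hg => ?_⟩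
  set K := N + F + 1 + (C + 1) * (N * C) with hK
  set Z : Finset ℕ := {z ∈ range (C + 1) | K ≤ #{i ∈ I | w i = z}} with hZ
  have hZpos : ∀ z ∈ Z, 0 < z := by
    intro z hz
    obtain ⟨i, hi⟩ := card_pos.1 (show 0 < #{i ∈ I | w i = z} by
      have := (mem_filter.1 hz).2; omega)
    rw [mem_filter] at hi
    exact hi.2 ▸ (hw i hi.1).1
  obtain ⟨hgw, hgM⟩ := hg (Nat.setGcd (Z : Set ℕ)) (fun z hz => by
    refine Nat.setGcd_dvd_of_mem (mem_coe.2 (mem_filter.2 ⟨?_, hz⟩))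
    obtain ⟨i, hi⟩ := card_pos.1 (show 0 < #{i ∈ I | w i = z} by omega)
    rw [mem_filter] at hi
    have := (hw i hi.1).2
    rw [mem_range]
    omega)
  have hres : ∀ z ∈ Z, ∃ S ⊆ {i ∈ I | w i = z}, #S = N := fun z hz =>
    exists_subset_card_eq (by have := (mem_filter.1 hz).2; omega)
  choose! S hS hSN using hres
  have hSI : Z.biUnion S ⊆ I := biUnion_subset.2 fun z hz => (hS z hz).trans (filter_subset _ _)
  refine exists_packing_of_reserve w hZpos (hF Z (filter_subset _ _)) hgM (by omega) hB I
    (Z.biUnion S) hSI ?_ ?_ (fun i hi => (hw i hi).2) hgw hsum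
  · calc ∑ i ∈ Z.biUnion S, w i ≤ ∑ i ∈ Z.biUnion S, C := sum_le_sum fun i hi => (hw i (hSI hi)).2
      _ = #(Z.biUnion S) * C := by rw [sum_const, smul_eq_mul]
      _ ≤ (#Z * N) * C := Nat.mul_le_mul_right _ (card_biUnion_le_card_mul _ _ _ fun z hz =>
          (hSN z hz).le)
      _ ≤ ((C + 1) * N) * C := by
          gcongr
          simpa using card_filter_le (range (C + 1)) _
      _ ≤ M := by rw [mul_assoc]; omega
  · intro z hz
    refine le_trans (Nat.mul_le_mul_right _ hBC) (le_trans (hSN z hz).ge (card_le_card ?_))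
    intro i hi
    exact mem_filter.2 ⟨mem_biUnion.2 ⟨z, hz, hi⟩, (mem_filter.1 (hS z hz hi)).2⟩

/-- Packing, class by class, for two consecutive levels of a tree with parent map `par`: the nodes
in `N'`, grouped into the classes of `c'`, are distributed over the nodes in `N`, in such a way
that classes are kept together, the class of the parent does not change, and all nodes in `N`
receive the same number of nodes. -/
theorem exists_binning (C : ℕ) : ∃ K : ℕ, ∀ {α κ κ' : Type} [Nonempty α] [DecidableEq α]
    [DecidableEq κ] [DecidableEq κ'] (N N' : Finset α) (par : α → α) (c : α → κ) (c' : α → κ') (M : ℕ),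
    (∀ ν ∈ N', par ν ∈ N) →
    (∀ ν ∈ N', ∀ ν' ∈ N', c' ν = c' ν' → c (par ν) = c (par ν')) →
    (∀ μ ∈ N, #{ν ∈ N' | par ν = μ} = M) →
    K ≤ M → (∀ μ ∈ N, #{μ' ∈ N | c μ' = c μ} ≤ C) →
    (∀ ν ∈ N', #{ν' ∈ N' | c' ν' = c' ν} ≤ C) →
    (∀ μ ∈ N, ∀ g : ℕ,
      (∀ z, K ≤ #{i ∈ {ν ∈ N' | c (par ν) = c μ}.image c' | #{ν ∈ N' | c' ν = i} = z} → g ∣ z) →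
      (∀ ν ∈ N', c (par ν) = c μ → g ∣ #{ν' ∈ N' | c' ν' = c' ν}) ∧ g ∣ M) →
    ∃ bin : α → α, (∀ ν ∈ N', bin ν ∈ N ∧ c (bin ν) = c (par ν)) ∧
      (∀ ν ∈ N', ∀ ν' ∈ N', c' ν = c' ν' → bin ν = bin ν') ∧
      ∀ μ ∈ N, #{ν ∈ N' | bin ν = μ} = M := by
  obtain ⟨K, hK⟩ := exists_packing C
  refine ⟨K, fun {α κ κ'} _ _ _ _ N N' par c c' M hpar hcc hM hKM hC hC' hg => ?_⟩
  have hfib : ∀ μ ∈ N, ∀ ν ∈ N', c (par ν) = c μ →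
      {ν' ∈ {ν ∈ N' | c (par ν) = c μ} | c' ν' = c' ν} = {ν' ∈ N' | c' ν' = c' ν} := by
    intro μ hμ ν hν hνμ
    ext ν'
    simp only [mem_filter]
    exact ⟨fun h => ⟨h.1.1, h.2⟩, fun h => ⟨⟨h.1, (hcc _ h.1 _ hν h.2).trans hνμ⟩, h.2⟩⟩
  have key : ∀ μ ∈ N, ∃ h : κ' → α,
      (∀ ν ∈ N', c (par ν) = c μ → h (c' ν) ∈ N ∧ c (h (c' ν)) = c μ) ∧
      ∀ μ' ∈ N, c μ' = c μ → #{ν ∈ N' | c (par ν) = c μ ∧ h (c' ν) = μ'} = M := by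
    intro μ hμ
    obtain ⟨h, hh1, hh2⟩ := hK (fun i => #{ν ∈ N' | c' ν = i})
      ({ν ∈ N' | c (par ν) = c μ}.image c') {μ' ∈ N | c μ' = c μ} M
      ⟨μ, mem_filter.2 ⟨hμ, rfl⟩⟩ (hC μ hμ) hKM (by
        intro i hi
        obtain ⟨ν, hν, rfl⟩ := mem_image.1 hi
        have hν' := (mem_filter.1 hν).1
        exact ⟨card_pos.2 ⟨ν, mem_filter.2 ⟨hν', rfl⟩⟩, hC' ν hν'⟩)
      (by
        have h1 : #{ν ∈ N' | c (par ν) = c μ} =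
            ∑ i ∈ {ν ∈ N' | c (par ν) = c μ}.image c', #{ν ∈ N' | c' ν = i} := by
          rw [card_eq_sum_card_image c']
          refine sum_congr rfl fun i hi => ?_
          obtain ⟨ν, hν, rfl⟩ := mem_image.1 hi
          rw [mem_filter] at hν
          rw [hfib μ hμ ν hν.1 hν.2]
        rw [← h1, card_eq_sum_card_fiberwise (f := par) (t := {μ' ∈ N | c μ' = c μ})
          (fun ν hν => ?_)]
        · rw [← smul_eq_mul, ← sum_const]
          refine sum_congr rfl fun μ' hμ' => ?_
          rw [mem_filter] at hμ'
          rw [← hM μ' hμ'.1, filter_filter]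
          congr 1
          ext ν
          simp only [mem_filter]
          exact ⟨fun h => ⟨h.1, h.2.2⟩, fun h => ⟨h.1, by rw [h.2, hμ'.2], h.2⟩⟩
        · have hν := mem_filter.1 (mem_coe.1 hν)
          exact mem_coe.2 (mem_filter.2 ⟨hpar ν hν.1, hν.2⟩))
      (fun g hz => by
        obtain ⟨h1, h2⟩ := hg μ hμ g hz
        refine ⟨fun i hi => ?_, h2⟩
        obtain ⟨ν, hν, rfl⟩ := mem_image.1 hi
        rw [mem_filter] at hν
        exact h1 ν hν.1 hν.2)
    refine ⟨h, fun ν hν hνμ => ?_, fun μ' hμ' hμμ => ?_⟩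
    · have := hh1 (c' ν) (mem_image_of_mem _ (mem_filter.2 ⟨hν, hνμ⟩))
      rwa [mem_filter] at this
    · rw [← hh2 μ' (mem_filter.2 ⟨hμ', hμμ⟩)]
      rw [card_eq_sum_card_fiberwise (f := c')
        (t := {i ∈ {ν ∈ N' | c (par ν) = c μ}.image c' | h i = μ'}) (fun ν hν => ?_)]
      · refine sum_congr rfl fun i hi => ?_
        rw [mem_filter] at hi
        obtain ⟨ν, hν, rfl⟩ := mem_image.1 hi.1
        rw [mem_filter] at hν
        rw [← hfib μ hμ ν hν.1 hν.2]
        congr 1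
        ext ν'
        simp only [mem_filter]
        exact ⟨fun h => ⟨⟨h.1.1, h.1.2.1⟩, h.2⟩,
          fun h => ⟨⟨h.1.1, h.1.2, by rw [h.2, hi.2]⟩, h.2⟩⟩
      · have hν := mem_filter.1 (mem_coe.1 hν)
        exact mem_coe.2 (mem_filter.2
          ⟨mem_image_of_mem _ (mem_filter.2 ⟨hν.1, hν.2.1⟩), hν.2.2⟩)
  -- one packing per class of `c`
  have key' : ∀ γ ∈ N.image c, ∃ h : κ' → α,
      (∀ ν ∈ N', c (par ν) = γ → h (c' ν) ∈ N ∧ c (h (c' ν)) = γ) ∧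
      ∀ μ' ∈ N, c μ' = γ → #{ν ∈ N' | c (par ν) = γ ∧ h (c' ν) = μ'} = M := by
    intro γ hγ
    obtain ⟨μ, hμ, rfl⟩ := mem_image.1 hγ
    exact key μ hμ
  choose! h hh using key'
  have hmem : ∀ ν ∈ N', c (par ν) ∈ N.image c := fun ν hν => mem_image_of_mem _ (hpar ν hν)
  refine ⟨fun ν => h (c (par ν)) (c' ν), fun ν hν => (hh _ (hmem ν hν)).1 ν hν rfl,
    fun ν hν ν' hν' he => ?_, fun μ hμ => ?_⟩
  · simp only [hcc ν hν ν' hν' he, he]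
  · rw [← (hh _ (mem_image_of_mem c hμ)).2 μ hμ rfl]
    congr 1
    ext ν
    simp only [mem_filter]
    constructor
    · rintro ⟨hν, rfl⟩
      have := ((hh _ (hmem ν hν)).1 ν hν rfl).2
      rw [this]
      exact ⟨hν, rfl, rfl⟩
    · rintro ⟨hν, h1, h2⟩
      exact ⟨hν, by rw [h1, h2]⟩

end Carpet

namespace Carpet

open Set

/-! ### Cells and clusters -/

/-- The combinatorial data of a carpet: `Y` is the set of heights of the non-empty rows, and `A t`
is the set of abscissae of the digits in row `t`. For `t ∉ Y` the value of `A t` is irrelevant; it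
is only required to have the common cardinality `a`. -/
structure RowSystem where
  (n m a : ℕ)
  (Y : Finset ℕ)
  (A : ℕ → Finset ℕ)
  two_le_m : 2 ≤ m
  m_lt_n : m < n
  Y_subset : Y ⊆ Finset.range m
  Y_nonempty : Y.Nonempty
  card_Y_lt : Y.card < m
  A_subset : ∀ t, A t ⊆ Finset.range n
  card_A : ∀ t, (A t).card = a
  a_pos : 0 < a
  a_lt_n : a < n
  two_le_mul : 2 ≤ a * Y.card

namespace RowSystem

variable (S : RowSystem)

theorem m_pos : 0 < S.m := by have := S.two_le_m; omega

theorem n_pos : 0 < S.n := by have := S.m_lt_n; omega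

/-- The integers with `L` digits in base `m`, all in `Y`. -/
def heights (L : ℕ) : Set ℕ := digitSet S.m (fun _ => S.Y) L

/-- The row that is prescribed for the `p`-th horizontal digit when `v` is read as an integer with
`L` digits in base `m`. -/
def rowAt (L v p : ℕ) : Finset ℕ := S.A (v / S.m ^ (L - 1 - p) % S.m)

/-- The integers with `k` digits in base `n` that are admissible at height `v`, where `v` has `L`
digits in base `m`. -/
def row (k L v : ℕ) : Set ℕ := digitSet S.n (S.rowAt L v) k

/-- The union of the rows over the run of `v` in `heights L`. -/
def shadow (k L v : ℕ) : Set ℕ := {x | ∃ v', uIcc v v' ⊆ S.heights L ∧ x ∈ S.row k L v'}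

/-- The cells of level `(k, L)`: the pair `(x, v)` stands for the points of the carpet in the
rectangle with lower left corner `(x / n ^ k, v / m ^ L)` and sides `n ^ (-k)`, `m ^ (-L)`. -/
noncomputable def cells (k L : ℕ) : Finset (ℕ × ℕ) := by
  classical
  exact (Finset.range (S.n ^ k) ×ˢ Finset.range (S.m ^ L)).filter
    fun p => p.2 ∈ S.heights L ∧ p.1 ∈ S.row k L p.2

/-- Two cells are linked if their heights belong to the same run and their abscissae belong to the
same run of the union of all rows over this run of heights. Cells that touch are linked. -/
def Linked (k L : ℕ) (p q : ℕ × ℕ) : Prop :=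
  uIcc p.2 q.2 ⊆ S.heights L ∧ uIcc p.1 q.1 ⊆ S.shadow k L p.2

/-- The cells linked to `p`. -/
noncomputable def cluster (k L : ℕ) (p : ℕ × ℕ) : Finset (ℕ × ℕ) := by
  classical exact (S.cells k L).filter (S.Linked k L p)

/-- The cell that contains `p`, `R` horizontal and `Δ` vertical digits up. -/
def parent (R Δ : ℕ) (p : ℕ × ℕ) : ℕ × ℕ := (p.1 / S.n ^ R, p.2 / S.m ^ Δ)

variable {S}
variable {k L R Δ : ℕ}

theorem mem_cells {p : ℕ × ℕ} : p ∈ S.cells k L ↔ p.2 ∈ S.heights L ∧ p.1 ∈ S.row k L p.2 := by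
  simp only [cells, Finset.mem_filter, Finset.mem_product, Finset.mem_range, and_iff_right_iff_imp]
  exact fun h => ⟨lt_of_mem_digitSet S.n_pos h.2, lt_of_mem_digitSet S.m_pos h.1⟩

theorem mem_cluster {p q : ℕ × ℕ} :
    q ∈ S.cluster k L p ↔ q ∈ S.cells k L ∧ S.Linked k L p q := by
  simp [cluster]

theorem shadow_eq {v v' : ℕ} (h : uIcc v v' ⊆ S.heights L) : S.shadow k L v = S.shadow k L v' :=
  ext fun _ => ⟨fun ⟨w, h1, h2⟩ => ⟨w, uIcc_subset_trans (uIcc_subset_symm h) h1, h2⟩,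
    fun ⟨w, h1, h2⟩ => ⟨w, uIcc_subset_trans h h1, h2⟩⟩

theorem row_subset_shadow {v v' : ℕ} (h : uIcc v v' ⊆ S.heights L) :
    S.row k L v' ⊆ S.shadow k L v := fun _ hx => ⟨v', h, hx⟩

theorem Linked.refl {p : ℕ × ℕ} (hp : p ∈ S.cells k L) : S.Linked k L p p := by
  rw [mem_cells] at hp
  have h := uIcc_self_subset hp.1
  exact ⟨h, uIcc_self_subset (row_subset_shadow h hp.2)⟩

theorem Linked.symm {p q : ℕ × ℕ} (h : S.Linked k L p q) : S.Linked k L q p :=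
  ⟨uIcc_subset_symm h.1, by rw [← shadow_eq h.1]; exact uIcc_subset_symm h.2⟩

theorem Linked.trans {p q r : ℕ × ℕ} (h : S.Linked k L p q) (h' : S.Linked k L q r) :
    S.Linked k L p r :=
  ⟨uIcc_subset_trans h.1 h'.1, uIcc_subset_trans h.2 (by rw [shadow_eq h.1]; exact h'.2)⟩

theorem cluster_eq_iff {p q : ℕ × ℕ} (hq : q ∈ S.cells k L) :
    S.cluster k L p = S.cluster k L q ↔ S.Linked k L p q := by
  constructor
  · intro h
    have : q ∈ S.cluster k L p := by rw [h, mem_cluster]; exact ⟨hq, .refl hq⟩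
    exact (mem_cluster.1 this).2
  · intro h
    ext r
    rw [mem_cluster, mem_cluster]
    exact ⟨fun hr => ⟨hr.1, h.symm.trans hr.2⟩, fun hr => ⟨hr.1, h.trans hr.2⟩⟩

theorem linked_of_close {p q : ℕ × ℕ} (hp : p ∈ S.cells k L) (hq : q ∈ S.cells k L)
    (h₁ : p.1 ≤ q.1 + 1) (h₂ : q.1 ≤ p.1 + 1) (h₃ : p.2 ≤ q.2 + 1) (h₄ : q.2 ≤ p.2 + 1) :
    S.Linked k L p q := by
  rw [mem_cells] at hp hq
  have h := uIcc_subset_of_close hp.1 hq.1 h₃ h₄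
  exact ⟨h, uIcc_subset_of_close (row_subset_shadow (uIcc_self_subset hp.1) hp.2)
    (row_subset_shadow h hq.2) h₁ h₂⟩

theorem row_eq_of_div_eq {v v' : ℕ} (hk : k < L) (h : v / S.m = v' / S.m) :
    S.row k L v = S.row k L v' := by
  refine digitSet_congr fun p hp => ?_
  obtain ⟨e, he⟩ : ∃ e, L - 1 - p = e + 1 := ⟨L - 2 - p, by omega⟩
  simp only [rowAt, he, pow_succ', ← Nat.div_div_eq_div_mul, h]

theorem rowAt_add {v p : ℕ} (hp : p < L) :
    S.rowAt (L + Δ) v p = S.rowAt L (v / S.m ^ Δ) p := by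
  rw [rowAt, rowAt, show L + Δ - 1 - p = Δ + (L - 1 - p) by omega, pow_add,
    Nat.div_div_eq_div_mul]

theorem row_add {v : ℕ} (hk : k ≤ L) : S.row k (L + Δ) v = S.row k L (v / S.m ^ Δ) :=
  digitSet_congr fun _ hp => rowAt_add (by omega)

theorem div_mem_heights {v : ℕ} (hv : v ∈ S.heights (L + Δ)) : v / S.m ^ Δ ∈ S.heights L :=
  div_pow_mem_digitSet Δ hv

theorem div_mem_row {x v : ℕ} (hk : k ≤ L) (hx : x ∈ S.row (k + R) (L + Δ) v) :
    x / S.n ^ R ∈ S.row k L (v / S.m ^ Δ) := by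
  rw [← row_add hk]
  exact div_pow_mem_digitSet R hx

theorem parent_mem_cells (hk : k ≤ L) {p : ℕ × ℕ} (hp : p ∈ S.cells (k + R) (L + Δ)) :
    S.parent R Δ p ∈ S.cells k L := by
  rw [mem_cells] at hp ⊢
  exact ⟨div_mem_heights hp.1, div_mem_row hk hp.2⟩

theorem uIcc_div_subset_heights {v v' : ℕ} (h : uIcc v v' ⊆ S.heights (L + Δ)) :
    uIcc (v / S.m ^ Δ) (v' / S.m ^ Δ) ⊆ S.heights L := by
  intro c hc
  obtain ⟨w, hw, rfl⟩ := exists_mem_uIcc_div_eq (pow_pos S.m_pos Δ) hc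
  exact div_mem_heights (h hw)

theorem Linked.parent (hk : k ≤ L) {p q : ℕ × ℕ} (h : S.Linked (k + R) (L + Δ) p q) :
    S.Linked k L (S.parent R Δ p) (S.parent R Δ q) := by
  refine ⟨uIcc_div_subset_heights h.1, fun c hc => ?_⟩
  obtain ⟨x, hx, rfl⟩ := exists_mem_uIcc_div_eq (pow_pos S.n_pos R) hc
  obtain ⟨w, hw, hxw⟩ := h.2 hx
  exact ⟨w / S.m ^ Δ, uIcc_div_subset_heights hw, div_mem_row hk hxw⟩

theorem exists_finset_heights {c : ℕ} (hc : c ∈ S.heights L) (Δ : ℕ) :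
    ∃ T : Finset ℕ, T.card = S.Y.card ^ Δ ∧
      ∀ v, v ∈ T ↔ v ∈ S.heights (L + Δ) ∧ v / S.m ^ Δ = c :=
  exists_finset_block (fun _ => S.Y_subset) (fun _ => rfl) hc Δ

theorem exists_finset_row {c v : ℕ} (hc : c ∈ S.row k L v) (q : ℕ) :
    ∃ T : Finset ℕ, T.card = S.a ^ q ∧
      ∀ x, x ∈ T ↔ x ∈ S.row (k + q) L v ∧ x / S.n ^ q = c :=
  exists_finset_block (fun _ => S.A_subset _) (fun _ => S.card_A _) hc q

/-- All cells have the same number of children: since `k + R ≤ L`, the rows from which the new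
horizontal digits are taken are already known. -/
theorem card_children (hk : k + R ≤ L) {p : ℕ × ℕ} (hp : p ∈ S.cells k L) :
    ((S.cells (k + R) (L + Δ)).filter fun q => S.parent R Δ q = p).card =
      S.a ^ R * S.Y.card ^ Δ := by
  rw [mem_cells] at hp
  obtain ⟨T, hTc, hT⟩ := exists_finset_row hp.2 R
  obtain ⟨U, hUc, hU⟩ := exists_finset_heights hp.1 Δ
  rw [← hTc, ← hUc, ← Finset.card_product]
  congr 1
  ext ⟨x, v⟩
  rw [Finset.mem_filter, Finset.mem_product, mem_cells, hT, hU, row_add hk, RowSystem.parent,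
    Prod.ext_iff]
  dsimp only
  constructor
  · rintro ⟨⟨h1, h2⟩, h3, h4⟩
    rw [h4] at h2
    exact ⟨⟨h2, h3⟩, h1, h4⟩
  · rintro ⟨⟨h2, h3⟩, h1, h4⟩
    exact ⟨⟨h1, by rwa [h4]⟩, h3, h4⟩

/-! ### Clusters are bounded -/

theorem exists_vacant : ∃ r < S.m, r ∉ S.Y := by
  obtain ⟨r, hr, hrY⟩ := Finset.exists_mem_notMem_of_card_lt_card
    (show S.Y.card < (Finset.range S.m).card by simpa using S.card_Y_lt)
  exact ⟨r, Finset.mem_range.1 hr, hrY⟩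

theorem lt_add_of_uIcc_subset_heights (hL : 0 < L) {u v : ℕ} (h : uIcc u v ⊆ S.heights L) :
    v < u + S.m := by
  obtain ⟨r, hr, hrY⟩ := S.exists_vacant
  obtain ⟨L, rfl⟩ := Nat.exists_eq_succ_of_ne_zero hL.ne'
  exact lt_add_of_uIcc_subset hr (fun x hx hxr => hrY (hxr ▸ hx.2)) h

/-- Over a run of heights there are at most two different rows: the run has at most `m` elements,
so it meets at most two blocks of `m` consecutive integers, and heights in the same block have the
same row. -/
theorem exists_shadow_subset (hk : k < L) (v : ℕ) :
    ∃ w w', S.shadow k L v ⊆ S.row k L w ∪ S.row k L w' := by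
  have hclose : ∀ {u u'}, uIcc v u ⊆ S.heights L → uIcc v u' ⊆ S.heights L →
      u / S.m ≤ u' / S.m + 1 := fun h h' => div_le_div_add_one S.m_pos
    (lt_add_of_uIcc_subset_heights (by omega)
      (uIcc_subset_trans (uIcc_subset_symm h') h)).le
  by_cases H : ∃ w, uIcc v w ⊆ S.heights L ∧ w / S.m ≠ v / S.m
  · obtain ⟨w, hw, hne⟩ := H
    refine ⟨v, w, fun x ⟨u, hu, hx⟩ => ?_⟩
    have hv : uIcc v v ⊆ S.heights L := uIcc_self_subset (hw left_mem_uIcc)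
    have h1 := hclose hw hv
    have h2 := hclose hv hw
    have h3 := hclose hu hv
    have h4 := hclose hv hu
    have h5 := hclose hu hw
    have h6 := hclose hw hu
    rcases (show u / S.m = v / S.m ∨ u / S.m = w / S.m by omega) with h | h
    · exact .inl (row_eq_of_div_eq hk h ▸ hx)
    · exact .inr (row_eq_of_div_eq hk h ▸ hx)
  · push Not at H
    exact ⟨v, v, fun x ⟨u, hu, hx⟩ => .inl (row_eq_of_div_eq hk (H u hu) ▸ hx)⟩

theorem lt_add_of_uIcc_subset_shadow {q : ℕ} (hq : 2 * S.a ^ q < S.n ^ q) (hqk : q ≤ k)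
    (hk : k < L) {v x y : ℕ} (h : uIcc x y ⊆ S.shadow k L v) : y < x + 2 * S.n ^ q := by
  by_contra! hxy
  obtain ⟨w, w', hw⟩ := S.exists_shadow_subset hk v
  obtain ⟨j, rfl⟩ : ∃ j, k = j + q := ⟨k - q, by omega⟩
  set N := S.n ^ q with hN
  have hNpos : 0 < N := pow_pos S.n_pos q
  -- the block `[N * c, N * (c + 1))` is contained in `[x, y]`
  set c := x / N + 1 with hc
  have hx := Nat.div_add_mod x N
  have hxm := Nat.mod_lt x hNpos
  have hblock : ∀ u, ∃ T : Finset ℕ, T.card ≤ S.a ^ q ∧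
      ∀ i < N, N * c + i ∈ S.row (j + q) L u → i ∈ T := by
    intro u
    by_cases hcu : c ∈ S.row j L u
    · obtain ⟨T, hT, hmem⟩ := exists_finset_row hcu q
      refine ⟨T.image fun z => z % N, Finset.card_image_le.trans hT.le, fun i hi hiu => ?_⟩
      exact Finset.mem_image.2 ⟨N * c + i, (hmem _).2 ⟨hiu, mul_add_div_of_lt hi c⟩,
        mul_add_mod_of_lt hi c⟩
    · refine ⟨∅, by simp, fun i hi hiu => absurd ?_ hcu⟩
      have := div_pow_mem_digitSet q hiu
      rwa [← hN, mul_add_div_of_lt hi] at this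
  obtain ⟨T, hTc, hT⟩ := hblock w
  obtain ⟨T', hTc', hT'⟩ := hblock w'
  have hsub : Finset.range N ⊆ T ∪ T' := by
    intro i hi
    rw [Finset.mem_range] at hi
    have hmem : N * c + i ∈ uIcc x y := by
      rw [mem_uIcc, hc, mul_add]
      omega
    rw [Finset.mem_union]
    exact (hw (h hmem)).imp (hT i hi) (hT' i hi)
  have h1 := (Finset.card_le_card hsub).trans (Finset.card_union_le _ _)
  rw [Finset.card_range] at h1
  omega

theorem Linked.bounds {q : ℕ} (hq : 2 * S.a ^ q < S.n ^ q) (hqk : q ≤ k) (hk : k < L)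
    {p p' : ℕ × ℕ} (h : S.Linked k L p p') :
    p'.1 < p.1 + 2 * S.n ^ q ∧ p'.2 < p.2 + S.m :=
  ⟨lt_add_of_uIcc_subset_shadow hq hqk hk h.2, lt_add_of_uIcc_subset_heights (by omega) h.1⟩

theorem card_cluster_le {q : ℕ} (hq : 2 * S.a ^ q < S.n ^ q) (hqk : q ≤ k) (hk : k < L)
    (p : ℕ × ℕ) : (S.cluster k L p).card ≤ 4 * S.n ^ q * (2 * S.m) := by
  have hsub : S.cluster k L p ⊆ Finset.Ico (p.1 - 2 * S.n ^ q) (p.1 + 2 * S.n ^ q) ×ˢ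
      Finset.Ico (p.2 - S.m) (p.2 + S.m) := by
    intro p' hp'
    have h := (mem_cluster.1 hp').2
    have h1 := h.bounds hq hqk hk
    have h2 := h.symm.bounds hq hqk hk
    simp only [Finset.mem_product, Finset.mem_Ico]
    omega
  refine (Finset.card_le_card hsub).trans ?_
  rw [Finset.card_product, Nat.card_Ico, Nat.card_Ico]
  exact Nat.mul_le_mul (by omega) (by omega)

end RowSystem

end Carpet

namespace Carpet

open Set

namespace RowSystem

variable {S : RowSystem} {k L R Δ : ℕ}

/-! ### Sizes of clusters -/

theorem lt_n_of_mem_A {t i : ℕ} (h : i ∈ S.A t) : i < S.n := Finset.mem_range.1 (S.A_subset t h)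

theorem lt_m_of_mem_Y {j : ℕ} (h : j ∈ S.Y) : j < S.m := Finset.mem_range.1 (S.Y_subset h)

theorem rowAt_subset (L v p : ℕ) : S.rowAt L v p ⊆ Finset.range S.n := S.A_subset _

theorem card_rowAt (L v p : ℕ) : (S.rowAt L v p).card = S.a := S.card_A _

theorem card_image_block {b c d e : ℕ} {T U : Finset ℕ} :
    ((T ×ˢ U).image fun y => (b * c + y.1, d * e + y.2)).card = T.card * U.card := by
  rw [Finset.card_image_of_injective _ fun y z h => ?_, Finset.card_product]
  simp only [Prod.mk.injEq, Nat.add_left_cancel_iff] at h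
  exact Prod.ext h.1 h.2

/-- Within a block of side one digit, a cluster is a product of a union of runs of a row of digits
with a union of runs of `Y`. -/
theorem dvd_card_cluster {g : ℕ} (hk : k < L) (p : ℕ × ℕ)
    (h : ∀ q ∈ S.cluster (k + 1) (L + 1) p, ∀ i ∈ S.rowAt (L + 1) q.2 k, ∀ j ∈ S.Y,
      g ∣ (component (S.rowAt (L + 1) q.2 k) i).card * (component S.Y j).card) :
    g ∣ (S.cluster (k + 1) (L + 1) p).card := by
  classical
  rw [Finset.card_eq_sum_card_image (fun q : ℕ × ℕ => (q.1 / S.n, q.2 / S.m))]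
  refine Finset.dvd_sum fun y hy => ?_
  obtain ⟨⟨x₁, v₁⟩, hq, rfl⟩ := Finset.mem_image.1 hy
  have h := h _ hq
  dsimp only at h ⊢
  rw [mem_cluster, mem_cells] at hq
  obtain ⟨⟨hv₁, hx₁⟩, hl₁, hl₂⟩ := hq
  dsimp only at hv₁ hx₁ hl₁ hl₂
  set B := S.rowAt (L + 1) v₁ k with hB
  set c := x₁ / S.n with hc
  set w := v₁ / S.m with hw
  set T := B.filter fun i => uIcc p.1 (S.n * c + i) ⊆ S.shadow (k + 1) (L + 1) p.2 with hT
  set U := S.Y.filter fun j => uIcc p.2 (S.m * w + j) ⊆ S.heights (L + 1) with hU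
  have hBn : ∀ {i}, i ∈ B → i < S.n := fun hi => lt_n_of_mem_A hi
  have hrow : ∀ {j}, j < S.m → S.row (k + 1) (L + 1) (S.m * w + j) = S.row (k + 1) (L + 1) v₁ :=
    fun hj => row_eq_of_div_eq (by omega) (by rw [mul_add_div_of_lt hj])
  have hmem_row : ∀ {i}, i ∈ B → S.n * c + i ∈ S.row (k + 1) (L + 1) v₁ := fun hi =>
    ⟨by rw [mul_add_div_of_lt (hBn hi)]; exact hx₁.1,
      by rwa [mul_add_mod_of_lt (hBn hi)]⟩
  have hmem_heights : ∀ {j}, j ∈ S.Y → S.m * w + j ∈ S.heights (L + 1) := fun hj =>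
    ⟨by rw [mul_add_div_of_lt (lt_m_of_mem_Y hj)]; exact hv₁.1,
      by rwa [mul_add_mod_of_lt (lt_m_of_mem_Y hj)]⟩
  have hfib : (S.cluster (k + 1) (L + 1) p).filter
      (fun q : ℕ × ℕ => (q.1 / S.n, q.2 / S.m) = (c, w)) =
      (T ×ˢ U).image fun y => (S.n * c + y.1, S.m * w + y.2) := by
    ext ⟨x, v⟩
    simp only [Finset.mem_filter, mem_cluster, mem_cells, Prod.mk.injEq, Finset.mem_image,
      Finset.mem_product, Prod.exists, hT, hU, Linked]
    constructor
    · rintro ⟨⟨⟨h1, h2⟩, h3, h4⟩, h5, h6⟩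
      have hx : S.n * c + x % S.n = x := by rw [← h5]; exact Nat.div_add_mod x S.n
      have hv : S.m * w + v % S.m = v := by rw [← h6]; exact Nat.div_add_mod v S.m
      refine ⟨x % S.n, v % S.m, ⟨⟨?_, by rwa [hx]⟩, ⟨h1.2, by rwa [hv]⟩⟩, hx, hv⟩
      rw [row_eq_of_div_eq (v' := v₁) (by omega) h6] at h2
      exact h2.2
    · rintro ⟨i, j, ⟨⟨hi, hi'⟩, hj, hj'⟩, rfl, rfl⟩
      have hjm := lt_m_of_mem_Y hj
      refine ⟨⟨⟨hmem_heights hj, ?_⟩, hj', hi'⟩, mul_add_div_of_lt (hBn hi) c,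
        mul_add_div_of_lt hjm w⟩
      rw [hrow hjm]
      exact hmem_row hi
  rw [hfib, card_image_block]
  have hblock : ∀ {b c' i i' y : ℕ}, y ∈ uIcc (b * c' + i) (b * c' + i') →
      ∃ l ∈ uIcc i i', y = b * c' + l := by
    intro b c' i i' y hy
    rw [mem_uIcc] at hy
    exact ⟨y - b * c', by rw [mem_uIcc]; omega, by omega⟩
  refine dvd_card_mul_of_saturated (Finset.filter_subset _ _) (fun i hi i' hii' => ?_)
    fun i hi => ?_
  · rw [Finset.mem_filter] at hi ⊢
    refine ⟨hii' right_mem_uIcc, uIcc_subset_trans hi.2 fun y hy => ?_⟩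
    obtain ⟨l, hl, rfl⟩ := hblock hy
    exact row_subset_shadow hl₁ (hmem_row (hii' hl))
  · rw [mul_comm]
    refine dvd_card_mul_of_saturated (Finset.filter_subset _ _) (fun j hj j' hjj' => ?_)
      fun j hj => ?_
    · rw [Finset.mem_filter] at hj ⊢
      refine ⟨hjj' right_mem_uIcc, uIcc_subset_trans hj.2 fun y hy => ?_⟩
      obtain ⟨l, hl, rfl⟩ := hblock hy
      exact hmem_heights (hjj' hl)
    · rw [mul_comm]
      exact h i hi j hj

/-- Below every cell there are many clusters which are a product of a given run of digits in a row
and a given run of digits in `Y`: by a suitable choice of the preceding digits they are separated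
from the neighbouring blocks. -/
theorem exists_product_clusters {r δ : ℕ} (hk : k + r + 2 ≤ L) {p : ℕ × ℕ} (hp : p ∈ S.cells k L)
    {i j : ℕ} (hi : i ∈ S.rowAt L p.2 (k + r + 1)) (hj : j ∈ S.Y) :
    ∃ T : Finset (ℕ × ℕ), T.card = S.a ^ r * S.Y.card ^ δ ∧
      (∀ q ∈ T, q ∈ S.cells (k + (r + 2)) (L + (δ + 2)) ∧ S.parent (r + 2) (δ + 2) q = p ∧
        (S.cluster (k + (r + 2)) (L + (δ + 2)) q).card =
          (component (S.rowAt L p.2 (k + r + 1)) i).card * (component S.Y j).card) ∧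
      ∀ q ∈ T, ∀ q' ∈ T, S.Linked (k + (r + 2)) (L + (δ + 2)) q q' → q = q' := by
  classical
  rw [mem_cells] at hp
  set B := S.rowAt L p.2 (k + r + 1) with hB
  obtain ⟨e, he, hE⟩ := exists_isolating_digit
    (rowAt_subset L p.2 (k + r + 1)) (rowAt_subset L p.2 (k + r))
    (by rw [card_rowAt]; exact S.a_lt_n) (by rw [card_rowAt]; exact S.a_lt_n)
    (Finset.card_pos.1 (by rw [card_rowAt]; exact S.a_pos)) hi
  obtain ⟨f, hf, hF⟩ := exists_isolating_digit S.Y_subset S.Y_subset S.card_Y_lt S.card_Y_lt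
    S.Y_nonempty hj
  have hin := lt_n_of_mem_A hi
  have hen := lt_n_of_mem_A he
  have hjm := lt_m_of_mem_Y hj
  have hfm := lt_m_of_mem_Y hf
  obtain ⟨X, hXc, hX⟩ := exists_finset_row hp.2 r
  obtain ⟨W, hWc, hW⟩ := exists_finset_heights hp.1 δ
  -- the cell over the blocks `x` and `w` that represents its cluster
  let rep : ℕ × ℕ → ℕ × ℕ := fun y =>
    (S.n * (S.n * y.1 + e) + i, S.m * (S.m * y.2 + f) + j)
  have hdiv : ∀ {w : ℕ}, w ∈ W → ∀ {v}, v / S.m = S.m * w + f → v / S.m ^ (δ + 2) = p.2 := by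
    intro w hw v hv
    rw [pow_succ', pow_succ', ← Nat.div_div_eq_div_mul, ← Nat.div_div_eq_div_mul, hv,
      mul_add_div_of_lt hfm]
    exact ((hW w).1 hw).2
  have hrow : ∀ {w : ℕ}, w ∈ W → ∀ {v}, v / S.m = S.m * w + f →
      S.row (k + (r + 2)) (L + (δ + 2)) v = {x | x / S.n ∈ {z | z / S.n ∈ S.row (k + r) L p.2 ∧
        z % S.n ∈ S.rowAt L p.2 (k + r)} ∧ x % S.n ∈ B} := by
    intro w hw v hv
    rw [row_add (by omega), hdiv hw hv]
    rfl
  have hlink : ∀ y ∈ X ×ˢ W, ∀ q', S.Linked (k + (r + 2)) (L + (δ + 2)) (rep y) q' ↔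
      (q'.1 / S.n = S.n * y.1 + e ∧ uIcc i (q'.1 % S.n) ⊆ (B : Set ℕ)) ∧
      (q'.2 / S.m = S.m * y.2 + f ∧ uIcc j (q'.2 % S.m) ⊆ (S.Y : Set ℕ)) := by
    rintro ⟨x, w⟩ hy ⟨x', v'⟩
    rw [Finset.mem_product] at hy
    have hheights : ∀ v, uIcc (rep (x, w)).2 v ⊆ S.heights (L + (δ + 2)) ↔
        v / S.m = S.m * w + f ∧ uIcc j (v % S.m) ⊆ (S.Y : Set ℕ) :=
      hF (S.heights (L + δ)) w ((hW w).1 hy.2).1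
    have hrep : (rep (x, w)).2 / S.m = S.m * w + f := mul_add_div_of_lt hjm _
    have hself : uIcc (rep (x, w)).2 (rep (x, w)).2 ⊆ S.heights (L + (δ + 2)) := by
      rw [hheights]
      exact ⟨hrep, (mul_add_mod_of_lt hjm (S.m * w + f)).symm ▸ uIcc_self_subset hj⟩
    have hshadow : S.shadow (k + (r + 2)) (L + (δ + 2)) (rep (x, w)).2 =
        S.row (k + (r + 2)) (L + (δ + 2)) (rep (x, w)).2 := by
      refine Subset.antisymm (fun z hz => ?_) (row_subset_shadow hself)
      obtain ⟨v, hv, hz⟩ := hz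
      rwa [hrow hy.2 hrep, ← hrow hy.2 ((hheights v).1 hv).1]
    rw [Linked, hheights, hshadow, hrow hy.2 hrep,
      show (rep (x, w)).1 = S.n * (S.n * x + e) + i from rfl,
      hE (S.row (k + r) L p.2) x ((hX x).1 hy.1).1]
    exact and_comm
  have hcell : ∀ y ∈ X ×ˢ W, ∀ q', S.Linked (k + (r + 2)) (L + (δ + 2)) (rep y) q' →
      q' ∈ S.cells (k + (r + 2)) (L + (δ + 2)) := by
    intro y hy q' hq'
    have h := (hlink y hy q').1 hq'
    have hw := (Finset.mem_product.1 hy).2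
    rw [mem_cells, hrow hw h.2.1]
    refine ⟨hq'.1 right_mem_uIcc, ⟨?_, h.1.2 right_mem_uIcc⟩⟩
    rw [h.1.1, mem_ofPred_eq, mul_add_div_of_lt hen, mul_add_mod_of_lt hen]
    exact ⟨((hX _).1 (Finset.mem_product.1 hy).1).1, he⟩
  have hself : ∀ y ∈ X ×ˢ W, S.Linked (k + (r + 2)) (L + (δ + 2)) (rep y) (rep y) := by
    intro y hy
    rw [hlink y hy]
    simp only [rep, mul_add_div_of_lt hin, mul_add_div_of_lt hjm, mul_add_mod_of_lt hin,
      mul_add_mod_of_lt hjm, true_and]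
    exact ⟨uIcc_self_subset hi, uIcc_self_subset hj⟩
  have hinj : ∀ y ∈ X ×ˢ W, ∀ y' ∈ X ×ˢ W,
      S.Linked (k + (r + 2)) (L + (δ + 2)) (rep y) (rep y') → y = y' := by
    intro y hy y' hy' h
    rw [hlink y hy] at h
    simp only [rep, mul_add_div_of_lt hin, mul_add_div_of_lt hjm] at h
    have h1 := congrArg (· / S.n) h.1.1
    have h2 := congrArg (· / S.m) h.2.1
    simp only [mul_add_div_of_lt hen, mul_add_div_of_lt hfm] at h1 h2
    exact Prod.ext h1.symm h2.symm
  refine ⟨(X ×ˢ W).image rep, ?_, ?_, ?_⟩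
  · rw [Finset.card_image_of_injOn, Finset.card_product, hXc, hWc]
    intro y hy y' hy' h
    exact hinj y hy y' hy' (h ▸ hself y hy)
  · intro q hq
    obtain ⟨⟨x, w⟩, hy, rfl⟩ := Finset.mem_image.1 hq
    refine ⟨hcell _ hy _ (hself _ hy), ?_, ?_⟩
    · refine Prod.ext ?_ (hdiv (Finset.mem_product.1 hy).2 (mul_add_div_of_lt hjm _))
      simp only [parent, rep]
      rw [pow_succ', pow_succ', ← Nat.div_div_eq_div_mul, ← Nat.div_div_eq_div_mul,
        mul_add_div_of_lt hin, mul_add_div_of_lt hen]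
      exact ((hX x).1 (Finset.mem_product.1 hy).1).2
    · rw [← card_image_block (b := S.n) (c := S.n * x + e) (d := S.m) (e := S.m * w + f)]
      congr 1
      ext q'
      simp only [mem_cluster, hlink _ hy, Finset.mem_image, Finset.mem_product, mem_component',
        Prod.exists]
      constructor
      · rintro ⟨-, ⟨h1, h2⟩, h3, h4⟩
        exact ⟨_, _, ⟨h2, h4⟩, Prod.ext (by dsimp only; rw [← h1, Nat.div_add_mod])
          (by dsimp only; rw [← h3, Nat.div_add_mod])⟩
      · rintro ⟨i', j', ⟨h1, h2⟩, rfl⟩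
        have hi' : i' < S.n := lt_n_of_mem_A (h1 right_mem_uIcc)
        have hj' : j' < S.m := lt_m_of_mem_Y (h2 right_mem_uIcc)
        have := (hlink _ hy (S.n * (S.n * x + e) + i', S.m * (S.m * w + f) + j')).2 (by
          simp only [mul_add_div_of_lt hi', mul_add_div_of_lt hj', mul_add_mod_of_lt hi',
            mul_add_mod_of_lt hj', true_and]
          exact ⟨h1, h2⟩)
        exact ⟨hcell _ hy _ this, (hlink _ hy _).1 this⟩
  · intro q hq q' hq' h
    obtain ⟨y, hy, rfl⟩ := Finset.mem_image.1 hq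
    obtain ⟨y', hy', rfl⟩ := Finset.mem_image.1 hq'
    rw [hinj y hy y' hy' h]

/-! ### Distributing clusters over cells -/

variable (S) in
/-- The clusters of a level can be distributed over the cells of a previous level such that every
cell receives as many cells as it has children, by a rearrangement inside the clusters of the
previous level. -/
theorem exists_cell_binning {q : ℕ} (hq : 2 * S.a ^ q < S.n ^ q) :
    ∃ r : ℕ, ∀ k L δ : ℕ, q ≤ k → k + r + 2 ≤ L → r ≤ δ →
      ∃ bin : ℕ × ℕ → ℕ × ℕ,
        (∀ ν ∈ S.cells (k + (r + 2)) (L + (δ + 2)),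
          bin ν ∈ S.cells k L ∧ S.Linked k L (bin ν) (S.parent (r + 2) (δ + 2) ν)) ∧
        (∀ ν ∈ S.cells (k + (r + 2)) (L + (δ + 2)), ∀ ν' ∈ S.cells (k + (r + 2)) (L + (δ + 2)),
          S.Linked (k + (r + 2)) (L + (δ + 2)) ν ν' → bin ν = bin ν') ∧
        ∀ μ ∈ S.cells k L, ((S.cells (k + (r + 2)) (L + (δ + 2))).filter (bin · = μ)).card =
          S.a ^ (r + 2) * S.Y.card ^ (δ + 2) := by
  classical
  obtain ⟨r, hr⟩ := exists_binning (4 * S.n ^ q * (2 * S.m))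
  refine ⟨r, fun k L δ hqk hkL hrδ => ?_⟩
  have hs : 0 < S.Y.card := S.Y_nonempty.card_pos
  have hlarge : r ≤ S.a ^ r * S.Y.card ^ δ := calc
    r ≤ 2 ^ r := Nat.lt_two_pow_self.le
    _ ≤ (S.a * S.Y.card) ^ r := Nat.pow_le_pow_left S.two_le_mul r
    _ = S.a ^ r * S.Y.card ^ r := mul_pow _ _ _
    _ ≤ S.a ^ r * S.Y.card ^ δ := Nat.mul_le_mul_left _ (Nat.pow_le_pow_right hs hrδ)
  have hM : S.a ^ r * S.Y.card ^ δ ≤ S.a ^ (r + 2) * S.Y.card ^ (δ + 2) :=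
    Nat.mul_le_mul (Nat.pow_le_pow_right S.a_pos (by omega))
      (Nat.pow_le_pow_right hs (by omega))
  have hfilter : ∀ {k L : ℕ}, ∀ ν ∈ S.cells k L,
      (S.cells k L).filter (fun ν' => S.cluster k L ν' = S.cluster k L ν) = S.cluster k L ν := by
    intro k L ν hν
    ext ν'
    rw [Finset.mem_filter, mem_cluster, cluster_eq_iff hν]
    exact and_congr_right fun _ => ⟨Linked.symm, Linked.symm⟩
  have hpar : ∀ ν ∈ S.cells (k + (r + 2)) (L + (δ + 2)),
      S.parent (r + 2) (δ + 2) ν ∈ S.cells k L := fun ν hν => parent_mem_cells (by omega) hν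
  obtain ⟨bin, h1, h2, h3⟩ := hr (S.cells k L) (S.cells (k + (r + 2)) (L + (δ + 2)))
    (S.parent (r + 2) (δ + 2)) (S.cluster k L) (S.cluster (k + (r + 2)) (L + (δ + 2)))
    (S.a ^ (r + 2) * S.Y.card ^ (δ + 2)) hpar
    (fun ν hν ν' hν' h =>
      (cluster_eq_iff (hpar ν' hν')).2 (((cluster_eq_iff hν').1 h).parent (by omega)))
    (fun μ hμ => card_children (by omega) hμ) (hlarge.trans hM)
    (fun μ hμ => by rw [hfilter μ hμ]; exact card_cluster_le hq hqk (by omega) μ)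
    (fun ν hν => by rw [hfilter ν hν]; exact card_cluster_le hq (by omega) (by omega) ν)
    (fun μ hμ g hg => by
      have hcomp : ∀ p ∈ S.cells k L, S.cluster k L p = S.cluster k L μ →
          ∀ i ∈ S.rowAt L p.2 (k + r + 1), ∀ j ∈ S.Y,
          g ∣ (component (S.rowAt L p.2 (k + r + 1)) i).card * (component S.Y j).card := by
        intro p hp hpμ i hi j hj
        obtain ⟨T, hTc, hT, hTinj⟩ := exists_product_clusters (δ := δ) hkL hp hi hj
        refine hg _ ((hlarge.trans hTc.ge).trans ?_)
        rw [← Finset.card_image_of_injOn (s := T)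
          (f := S.cluster (k + (r + 2)) (L + (δ + 2)))
          (fun t ht t' ht' h => hTinj t ht t' ht' ((cluster_eq_iff (hT t' ht').1).1 h))]
        refine Finset.card_le_card fun C hC => ?_
        obtain ⟨t, ht, rfl⟩ := Finset.mem_image.1 hC
        obtain ⟨ht1, ht2, ht3⟩ := hT t ht
        refine Finset.mem_filter.2 ⟨Finset.mem_image_of_mem _ (Finset.mem_filter.2
          ⟨ht1, by rw [ht2, hpμ]⟩), by rw [hfilter t ht1, ht3]⟩
      refine ⟨fun ν hν hνμ => ?_, ?_⟩
      · rw [hfilter ν hν]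
        refine dvd_card_cluster (k := k + (r + 1)) (L := L + (δ + 1)) (by omega) ν
          fun q hq => ?_
        rw [show S.rowAt (L + (δ + 1) + 1) q.2 (k + (r + 1)) =
          S.rowAt L (S.parent (r + 2) (δ + 2) q).2 (k + r + 1) from
            rowAt_add (Δ := δ + 2) (by omega)]
        have hq := mem_cluster.1 hq
        refine hcomp _ (hpar q hq.1) ?_
        rw [← hνμ, cluster_eq_iff (hpar ν hν)]
        exact Linked.parent (R := r + 2) (Δ := δ + 2) (by omega) hq.2.symm
      · have hg' : g ∣ (S.rowAt L μ.2 (k + r + 1)).card * S.Y.card := by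
          refine dvd_card_mul_of_saturated subset_rfl (fun i _ j hj => hj right_mem_uIcc)
            fun i hi => ?_
          rw [mul_comm]
          refine dvd_card_mul_of_saturated subset_rfl (fun i _ j hj => hj right_mem_uIcc)
            fun j hj => ?_
          rw [mul_comm]
          exact hcomp μ hμ rfl i hi j hj
        rw [card_rowAt] at hg'
        exact hg'.trans (mul_dvd_mul (dvd_pow_self _ (by omega)) (dvd_pow_self _ (by omega))))
  exact ⟨bin, fun ν hν => ⟨(h1 ν hν).1, (cluster_eq_iff (hpar ν hν)).1 (h1 ν hν).2⟩,
    fun ν hν ν' hν' h => h2 ν hν ν' hν' ((cluster_eq_iff hν').2 h), h3⟩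

end RowSystem

end Carpet

namespace Carpet

/-! ### Prefixes of digit sequences -/

/-- The integer whose base `b` digits are the first `k` terms of `u`. -/
def prefixNum {b : ℕ} (u : ℕ → Fin b) : ℕ → ℕ
  | 0 => 0
  | k + 1 => b * prefixNum u k + u k

theorem prefixNum_succ {b : ℕ} (u : ℕ → Fin b) (k : ℕ) :
    prefixNum u (k + 1) = b * prefixNum u k + u k := rfl

theorem prefixNum_succ_div {b : ℕ} (u : ℕ → Fin b) (k : ℕ) :
    prefixNum u (k + 1) / b = prefixNum u k := mul_add_div_of_lt (u k).2 _

theorem prefixNum_succ_mod {b : ℕ} (u : ℕ → Fin b) (k : ℕ) :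
    prefixNum u (k + 1) % b = u k := mul_add_mod_of_lt (u k).2 _

theorem prefixNum_add_div {b : ℕ} (u : ℕ → Fin b) (k q : ℕ) :
    prefixNum u (k + q) / b ^ q = prefixNum u k := by
  induction q with
  | zero => simp
  | succ q ih => rw [← add_assoc, pow_succ', ← Nat.div_div_eq_div_mul, prefixNum_succ_div, ih]

theorem prefixNum_digit {b : ℕ} (u : ℕ → Fin b) {k p : ℕ} (hp : p < k) :
    prefixNum u k / b ^ (k - 1 - p) % b = u p := by
  obtain ⟨e, rfl⟩ : ∃ e, k = p + 1 + e := ⟨k - (p + 1), by omega⟩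
  rw [show p + 1 + e - 1 - p = e by omega, prefixNum_add_div, prefixNum_succ_mod]

theorem prefixNum_eq_iff {b : ℕ} {u v : ℕ → Fin b} {k : ℕ} :
    prefixNum u k = prefixNum v k ↔ ∀ p < k, u p = v p := by
  constructor
  · intro h p hp
    rw [Fin.ext_iff, ← prefixNum_digit u hp, h, prefixNum_digit v hp]
  · intro h
    induction k with
    | zero => rfl
    | succ k ih =>
      rw [prefixNum_succ, prefixNum_succ, ih fun p hp => h p (by omega), h k (by omega)]

theorem prefixNum_mem_digitSet {b : ℕ} {A : ℕ → Finset ℕ} {u : ℕ → Fin b} {k : ℕ} :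
    prefixNum u k ∈ digitSet b A k ↔ ∀ p < k, (u p : ℕ) ∈ A p := by
  induction k with
  | zero => simp [prefixNum, digitSet]
  | succ k ih =>
    rw [mem_digitSet_succ, prefixNum_succ_div, prefixNum_succ_mod, ih, Nat.forall_lt_succ_right]

theorem exists_prefixNum_eq {b : ℕ} (hb : 0 < b) {k x : ℕ} (hx : x < b ^ k) :
    ∃ u : ℕ → Fin b, prefixNum u k = x := by
  induction k generalizing x with
  | zero => exact ⟨fun _ => ⟨0, hb⟩, by simp only [pow_zero] at hx; simp [prefixNum]; omega⟩
  | succ k ih =>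
    obtain ⟨u, hu⟩ := ih (x := x / b) (by rwa [Nat.div_lt_iff_lt_mul hb, ← pow_succ])
    refine ⟨Function.update u k ⟨x % b, Nat.mod_lt _ hb⟩, ?_⟩
    rw [prefixNum_succ, Function.update_self, (prefixNum_eq_iff (v := u)).2
      fun p hp => Function.update_of_ne hp.ne _ _, hu, Nat.div_add_mod]

theorem pow_mul_ofDigits {b : ℕ} (u : ℕ → Fin b) (k : ℕ) :
    (b : ℝ) ^ k * Real.ofDigits u = prefixNum u k + Real.ofDigits fun i => u (i + k) := by
  have hb : (b : ℝ) ≠ 0 := Nat.cast_ne_zero.2 (Fin.pos (u 0)).ne'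
  have hsum : (b : ℝ) ^ k * ∑ i ∈ Finset.range k, Real.ofDigitsTerm u i = prefixNum u k := by
    induction k with
    | zero => simp [prefixNum]
    | succ k ih =>
      rw [Finset.sum_range_succ, mul_add, pow_succ', mul_assoc, ih, prefixNum_succ,
        Real.ofDigitsTerm, pow_succ']
      push_cast
      field_simp
  rw [Real.ofDigits_eq_sum_add_ofDigits u k, mul_add, hsum, mul_inv_cancel_left₀ (pow_ne_zero _ hb)]

theorem prefixNum_le_pow_mul_ofDigits {b : ℕ} (u : ℕ → Fin b) (k : ℕ) :
    (prefixNum u k : ℝ) ≤ b ^ k * Real.ofDigits u := by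
  rw [pow_mul_ofDigits]
  linarith [Real.ofDigits_nonneg fun i => u (i + k)]

theorem pow_mul_ofDigits_le {b : ℕ} (u : ℕ → Fin b) (k : ℕ) :
    (b : ℝ) ^ k * Real.ofDigits u ≤ prefixNum u k + 1 := by
  rw [pow_mul_ofDigits]
  linarith [Real.ofDigits_le_one fun i => u (i + k)]

theorem prefixNum_le_add_one {b : ℕ} {u v : ℕ → Fin b} {k : ℕ}
    (h : (b : ℝ) ^ k * |Real.ofDigits u - Real.ofDigits v| < 1) :
    prefixNum u k ≤ prefixNum v k + 1 := by
  have h1 := prefixNum_le_pow_mul_ofDigits u k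
  have h2 := pow_mul_ofDigits_le v k
  have h3 := mul_le_mul_of_nonneg_left (le_abs_self (Real.ofDigits u - Real.ofDigits v))
    (show (0 : ℝ) ≤ b ^ k by positivity)
  have h4 : (prefixNum u k : ℝ) < (prefixNum v k + 1 + 1 : ℕ) := by push_cast; linarith
  exact Nat.lt_succ_iff.1 (Nat.cast_lt.1 h4)

theorem pow_mul_abs_ofDigits_sub_le {b : ℕ} {u v : ℕ → Fin b} {k c : ℕ}
    (h₁ : prefixNum u k ≤ prefixNum v k + c) (h₂ : prefixNum v k ≤ prefixNum u k + c) :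
    (b : ℝ) ^ k * |Real.ofDigits u - Real.ofDigits v| ≤ c + 1 := by
  rw [← abs_of_nonneg (show (0 : ℝ) ≤ b ^ k by positivity), ← abs_mul, abs_le]
  have h₁' : (prefixNum u k : ℝ) ≤ prefixNum v k + c := by exact_mod_cast h₁
  have h₂' : (prefixNum v k : ℝ) ≤ prefixNum u k + c := by exact_mod_cast h₂
  have := prefixNum_le_pow_mul_ofDigits u k
  have := pow_mul_ofDigits_le u k
  have := prefixNum_le_pow_mul_ofDigits v k
  have := pow_mul_ofDigits_le v k
  constructor <;> linarith

theorem prefixDist_le {α : Type*} {ξ : ℝ} (h0 : 0 ≤ ξ) (h1 : ξ ≤ 1) {u v : ℕ → α} {k : ℕ}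
    (h : ∀ p < k, u p = v p) : prefixDist ξ u v ≤ ξ ^ k := by
  unfold prefixDist
  split_ifs with huv
  · positivity
  · refine pow_le_pow_of_le_one h0 h1 ?_
    by_contra! hlt
    exact PiNat.apply_firstDiff_ne huv (h _ hlt)

theorem le_prefixDist {α : Type*} {ξ : ℝ} (h0 : 0 ≤ ξ) (h1 : ξ ≤ 1) {u v : ℕ → α} {k : ℕ}
    (h : ¬ ∀ p < k, u p = v p) : ξ ^ k ≤ prefixDist ξ u v := by
  push Not at h
  obtain ⟨p, hp, hne⟩ := h
  unfold prefixDist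
  rw [if_neg fun huv => hne (congrFun huv p)]
  refine pow_le_pow_of_le_one h0 h1 ?_
  by_contra! hlt
  exact hne (PiNat.apply_eq_of_lt_firstDiff (by omega))

/-! ### The coding of the carpet -/

section Coding

variable {n m : ℕ} {D : Finset (Fin n × Fin m)}

/-- The point of the carpet with a given sequence of digits. -/
noncomputable def point (w : DigitSpace D) : Plane :=
  !₂[Real.ofDigits w.fstSeq, Real.ofDigits w.sndSeq]

theorem ofDigits_eq_div {b : ℕ} (u : ℕ → Fin b) :
    Real.ofDigits u = (Real.ofDigits (fun i => u (i + 1)) + (u 0 : ℕ)) / b := by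
  have hb : (b : ℝ) ≠ 0 := Nat.cast_ne_zero.2 (Fin.pos (u 0)).ne'
  have := pow_mul_ofDigits u 1
  rw [pow_one, prefixNum_succ] at this
  rw [eq_div_iff hb, mul_comm, this]
  simp [prefixNum, add_comm]

theorem point_eq_digitMap (w : DigitSpace D) :
    point w = digitMap (w 0).1 (point (D := D) fun k => w (k + 1)) := by
  rw [point, ofDigits_eq_div w.fstSeq, ofDigits_eq_div w.sndSeq]
  rfl

theorem isCompact_range_point : IsCompact (Set.range (point (D := D))) := by
  have hf : ∀ {b : ℕ} (g : D → Fin b), Continuous fun w : ℕ → D => Real.ofDigits fun k => g (w k) :=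
    fun g => Real.continuous_ofDigits.comp
      (continuous_pi fun k => continuous_of_discreteTopology.comp (continuous_apply k))
  have hc : Continuous fun w : ℕ → D => (!₂[Real.ofDigits fun k => (w k).1.1,
      Real.ofDigits fun k => (w k).1.2] : Plane) := by
    refine (PiLp.continuous_toLp 2 _).comp (continuous_pi fun i => ?_)
    fin_cases i
    · exact hf fun d => d.1.1
    · exact hf fun d => d.1.2
  have h := isCompact_range hc
  exact h

theorem isCarpet_range_point (hD : D.Nonempty) : IsCarpet D (Set.range (point (D := D))) := by
  obtain ⟨d, hd⟩ := hD
  refine ⟨⟨_, (fun _ => ⟨d, hd⟩ : DigitSpace D), rfl⟩, isCompact_range_point, ?_⟩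
  ext z
  simp only [Set.mem_range, Set.mem_iUnion, Set.mem_image, exists_prop]
  constructor
  · rintro ⟨w, rfl⟩
    exact ⟨_, (w 0).2, _, ⟨_, rfl⟩, (point_eq_digitMap w).symm⟩
  · rintro ⟨e, he, _, ⟨w, rfl⟩, rfl⟩
    let w' : DigitSpace D := fun k => match k with
      | 0 => ⟨e, he⟩
      | k + 1 => w k
    exact ⟨w', point_eq_digitMap w'⟩

/-- A full row yields a horizontal segment in the carpet. -/
theorem exists_notMem_of_isTotallyDisconnected (hn : 1 < n)
    (ht : IsTotallyDisconnected (Set.range (point (D := D)))) (j : Fin m) : ∃ i, (i, j) ∉ D := by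
  by_contra! hj
  set c : ℝ := Real.ofDigits fun _ : ℕ => j
  have hseg : (fun x : ℝ => (!₂[x, c] : Plane)) '' Set.Icc 0 1 ⊆ Set.range (point (D := D)) := by
    rintro _ ⟨x, hx, rfl⟩
    obtain ⟨u, -, rfl⟩ := Real.ofDigits_SurjOn hn hx
    exact ⟨fun k => ⟨(u k, j), hj _⟩, rfl⟩
  have hcont : Continuous fun x : ℝ => (!₂[x, c] : Plane) := by
    refine (PiLp.continuous_toLp 2 _).comp (continuous_pi fun i => ?_)
    fin_cases i
    · exact continuous_id
    · exact continuous_const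
  have h := ht _ hseg (isPreconnected_Icc.image _ hcont.continuousOn)
    ⟨0, by simp, rfl⟩ ⟨1, by simp, rfl⟩
  have h0 := congrArg (fun z : Plane => z 0) h
  simp at h0

end Coding

/-- The digit sets considered here are described by a `RowSystem`. -/
theorem exists_rowSystem {n m : ℕ} (hm : 2 ≤ m) (hmn : m < n) (D : Finset (Fin n × Fin m))
    (hN : 1 < D.card) (ht : ∀ j, ∃ i, (i, j) ∉ D) (hv : HasVacantRow D)
    (hr : HasUniformFibers D) :
    ∃ S : RowSystem, S.n = n ∧ S.m = m ∧
      ∀ d : Fin n × Fin m, d ∈ D ↔ (d.2 : ℕ) ∈ S.Y ∧ (d.1 : ℕ) ∈ S.A d.2 := by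
  classical
  obtain ⟨⟨i₀, j₀⟩, h₀⟩ := Finset.card_pos.1 (show 0 < D.card by omega)
  have hpos : ∀ {i j}, (i, j) ∈ D → rowCount D j ≠ 0 := fun {i j} h =>
    Finset.card_ne_zero_of_mem (a := i) (by simpa using h)
  set Y : Finset ℕ := D.image fun d => (d.2 : ℕ) with hY
  set B : ℕ → Finset ℕ := fun t =>
    (D.filter fun d => (d.2 : ℕ) = t).image fun d => (d.1 : ℕ) with hB
  have hmemB : ∀ (i : Fin n) (j : Fin m), (i : ℕ) ∈ B j ↔ (i, j) ∈ D := by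
    intro i j
    simp only [hB, Finset.mem_image, Finset.mem_filter, Prod.exists, Fin.val_inj]
    exact ⟨by rintro ⟨_, _, ⟨h, rfl⟩, rfl⟩; exact h, fun h => ⟨i, j, ⟨h, rfl⟩, rfl⟩⟩
  have hBn : ∀ t, B t ⊆ Finset.range n := by
    intro t i hi
    obtain ⟨d, -, rfl⟩ := Finset.mem_image.1 hi
    exact Finset.mem_range.2 d.1.2
  have hBcard : ∀ j : Fin m, (B j).card = rowCount D j := by
    intro j
    suffices h : B j = (Finset.univ.filter fun i : Fin n => (i, j) ∈ D).image Fin.val by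
      rw [h, Finset.card_image_of_injective _ Fin.val_injective, rowCount]
    ext i
    constructor
    · intro hi
      exact Finset.mem_image.2 ⟨⟨i, Finset.mem_range.1 (hBn _ hi)⟩,
        by simpa using (hmemB ⟨i, _⟩ j).1 hi, rfl⟩
    · intro hi
      obtain ⟨i, hij, rfl⟩ := Finset.mem_image.1 hi
      exact (hmemB i j).2 (by simpa using hij)
  have hBa : ∀ t ∈ Y, (B t).card = rowCount D j₀ := by
    intro t ht
    obtain ⟨⟨i, j⟩, hd, rfl⟩ := Finset.mem_image.1 ht
    rw [hBcard]
    exact hr _ _ (hpos hd) (hpos h₀)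
  have ha : rowCount D j₀ < n := by
    obtain ⟨i, hi⟩ := ht j₀
    have := Finset.card_lt_univ_of_notMem
      (s := Finset.univ.filter fun i : Fin n => (i, j₀) ∈ D) (x := i) (by simpa using hi)
    simpa [rowCount] using this
  have hYm : Y ⊆ Finset.range m := by
    intro t ht
    obtain ⟨d, -, rfl⟩ := Finset.mem_image.1 ht
    exact Finset.mem_range.2 d.2.2
  refine ⟨{ n := n, m := m, a := rowCount D j₀, Y := Y,
            A := fun t => if t ∈ Y then B t else Finset.range (rowCount D j₀)
            two_le_m := hm, m_lt_n := hmn, Y_subset := hYm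
            Y_nonempty := ⟨_, Finset.mem_image_of_mem _ h₀⟩
            card_Y_lt := ?_, A_subset := ?_, card_A := ?_
            a_pos := Nat.pos_of_ne_zero (hpos h₀), a_lt_n := ha, two_le_mul := ?_ },
    rfl, rfl, ?_⟩
  · obtain ⟨j, hj⟩ := hv
    rw [← Finset.card_range m]
    refine Finset.card_lt_card ⟨hYm, fun h => ?_⟩
    obtain ⟨⟨i, j'⟩, hd, he⟩ := Finset.mem_image.1 (h (Finset.mem_range.2 j.2))
    obtain rfl : j' = j := Fin.ext he
    exact hpos hd hj
  · intro t
    split_ifs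
    exacts [hBn t, Finset.range_subset_range.2 ha.le]
  · intro t
    split_ifs with h
    exacts [hBa t h, Finset.card_range _]
  · refine le_trans hN (Finset.card_le_mul_card_image _ _ fun t ht => ?_)
    rw [← hBa t ht, hB, Finset.card_image_of_injOn]
    rintro ⟨i, j⟩ hd ⟨i', j'⟩ hd' h
    simp only [Finset.coe_filter, Set.mem_ofPred_eq] at hd hd'
    exact Prod.ext (Fin.ext h) (Fin.ext (hd.2.trans hd'.2.symm))
  · rintro ⟨i, j⟩
    dsimp only
    constructor
    · intro h
      have hj : (j : ℕ) ∈ Y := Finset.mem_image_of_mem (fun d : Fin n × Fin m => (d.2 : ℕ)) h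
      rw [if_pos hj, hmemB]
      exact ⟨hj, h⟩
    · rintro ⟨hj, hi⟩
      rwa [if_pos hj, hmemB] at hi

end Carpet

namespace Carpet

/-! ### Rearranging a homogeneous tree -/

theorem natCard_fiber {α β : Type*} [DecidableEq β] {s : Finset α} {t : Finset β} {g : α → β}
    (f : s → t) (hf : ∀ x, (f x : β) = g x) (μ : t) :
    Nat.card {x // f x = μ} = (s.filter (g · = μ)).card := by
  classical
  let e : {x // f x = μ} ≃ s.filter (g · = μ) :=
    { toFun := fun x => ⟨x.1, Finset.mem_filter.2 ⟨x.1.2, by rw [← hf, x.2]⟩⟩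
      invFun := fun x => ⟨⟨x.1, (Finset.mem_filter.1 x.2).1⟩,
        Subtype.ext ((hf _).trans (Finset.mem_filter.1 x.2).2)⟩
      left_inv := fun _ => rfl
      right_inv := fun _ => rfl }
  rw [Nat.card_congr e, Nat.card_eq_fintype_card, Fintype.card_coe]

/-- If two maps `par` and `bin` from each level of a tree to the previous one have fibres of the
same size, then the tree structures defined by them are isomorphic. -/
theorem exists_level_equivs {N : ℕ → Type*} [∀ i, Finite (N i)] (par bin : ∀ i, N (i + 1) → N i)
    (M : ℕ → ℕ) (hpar : ∀ i μ, Nat.card {ν // par i ν = μ} = M i)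
    (hbin : ∀ i μ, Nat.card {ν // bin i ν = μ} = M i) :
    ∃ φ : ∀ i, N i ≃ N i, ∀ i ν, par i (φ (i + 1) ν) = φ i (bin i ν) := by
  have step : ∀ i (φ : N i ≃ N i), ∃ ψ : N (i + 1) ≃ N (i + 1),
      ∀ ν, par i (ψ ν) = φ (bin i ν) := by
    intro i φ
    have e : ∀ μ, Nonempty ({ν // φ (bin i ν) = μ} ≃ {ν // par i ν = μ}) := by
      intro μ
      refine ⟨(Equiv.subtypeEquivRight fun ν => ?_).trans
        (Finite.card_eq.1 ((hbin i (φ.symm μ)).trans (hpar i μ).symm)).some⟩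
      exact (Equiv.eq_symm_apply φ).symm
    exact ⟨Equiv.ofFiberEquiv fun μ => (e μ).some, Equiv.ofFiberEquiv_map _⟩
  choose next hnext using step
  exact ⟨fun i => Nat.rec (Equiv.refl _) next i, fun i => hnext i _⟩

/-! ### The sequence of levels -/

theorem pow_mul_add_le_mul_pow (c : ℕ) (k : ℕ) : c ^ k * (c + k) ≤ c * (c + 1) ^ k := by
  induction k with
  | zero => simp
  | succ k ih =>
    calc c ^ (k + 1) * (c + (k + 1)) = c ^ k * (c * (c + k + 1)) := by ring
      _ ≤ c ^ k * ((c + 1) * (c + k)) := Nat.mul_le_mul_left _ (by ring_nf; omega)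
      _ = (c + 1) * (c ^ k * (c + k)) := by ring
      _ ≤ (c + 1) * (c * (c + 1) ^ k) := Nat.mul_le_mul_left _ ih
      _ = c * (c + 1) ^ (k + 1) := by ring

theorem exists_two_mul_pow_lt_pow {a n : ℕ} (ha : 0 < a) (han : a < n) :
    ∃ q, 2 * a ^ q < n ^ q := by
  refine ⟨a + 1, Nat.lt_of_mul_lt_mul_left (a := a) ?_⟩
  calc a * (2 * a ^ (a + 1)) < a ^ (a + 1) * (a + (a + 1)) := by
        have : 0 < a ^ (a + 1) := pow_pos ha _
        nlinarith
    _ ≤ a * (a + 1) ^ (a + 1) := pow_mul_add_le_mul_pow a (a + 1)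
    _ ≤ a * n ^ (a + 1) := Nat.mul_le_mul_left _ (Nat.pow_le_pow_left han _)

namespace RowSystem

variable (S : RowSystem)

/-- The number of vertical digits that matches `k` horizontal digits: the cells of level
`(k, S.height k)` are squares up to a bounded factor. -/
def height (k : ℕ) : ℕ := Nat.clog S.m (S.n ^ k)

theorem pow_le_pow_height (k : ℕ) : S.n ^ k ≤ S.m ^ S.height k :=
  Nat.le_pow_clog S.two_le_m _

theorem pow_height_pred_lt {k : ℕ} (hk : 0 < k) : S.m ^ (S.height k - 1) < S.n ^ k :=
  Nat.pow_pred_clog_lt_self S.two_le_m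
    (Nat.one_lt_pow hk.ne' (by have := S.two_le_m; have := S.m_lt_n; omega))

theorem le_height {k j : ℕ} (h : S.m ^ j ≤ S.n ^ k) : j ≤ S.height k :=
  (Nat.pow_le_pow_iff_right S.two_le_m).1 (h.trans (S.pow_le_pow_height k))

theorem self_le_height (k : ℕ) : k ≤ S.height k :=
  S.le_height (Nat.pow_le_pow_left S.m_lt_n.le k)

theorem pow_height_le {k : ℕ} (hk : 0 < k) : S.m ^ S.height k ≤ S.m * S.n ^ k := by
  have h := S.self_le_height k
  calc S.m ^ S.height k = S.m * S.m ^ (S.height k - 1) := by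
        rw [← pow_succ', Nat.sub_add_cancel (by omega)]
    _ ≤ S.m * S.n ^ k := Nat.mul_le_mul_left _ (S.pow_height_pred_lt hk).le

theorem height_add_le {k : ℕ} (hk : 0 < k) (r : ℕ) : S.height k + r ≤ S.height (k + r) := by
  by_contra! hlt
  have h := S.self_le_height k
  have h1 : S.m ^ S.height (k + r) ≤ S.m ^ (S.height k - 1 + r) :=
    Nat.pow_le_pow_right S.m_pos (by omega)
  have h2 : S.m ^ (S.height k - 1 + r) < S.n ^ k * S.n ^ r := by
    rw [pow_add]
    exact Nat.mul_lt_mul_of_lt_of_le (S.pow_height_pred_lt hk)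
      (Nat.pow_le_pow_left S.m_lt_n.le r) (pow_pos S.n_pos r)
  rw [← pow_add] at h2
  exact absurd (S.pow_le_pow_height (k + r)) (by omega)

theorem add_le_height {k r : ℕ} (hk : S.m ^ (r + 1) ≤ k) : k + r ≤ S.height k := by
  refine S.le_height (Nat.le_of_mul_le_mul_left (c := S.m) ?_ S.m_pos)
  calc S.m * S.m ^ (k + r) = S.m ^ k * S.m ^ (r + 1) := by ring
    _ ≤ S.m ^ k * (S.m + k) := Nat.mul_le_mul_left _ (by omega)
    _ ≤ S.m * (S.m + 1) ^ k := pow_mul_add_le_mul_pow S.m k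
    _ ≤ S.m * S.n ^ k := Nat.mul_le_mul_left _ (Nat.pow_le_pow_left S.m_lt_n k)

theorem height_le_height_add (k r : ℕ) : S.height k ≤ S.height (k + r) :=
  Nat.clog_mono_right _ (Nat.pow_le_pow_right S.n_pos (by omega))

/-- The approximate squares of level `k`: cells of width `n ^ (-k)` and comparable height. -/
def Square (k : ℕ) : Type := S.cells k (S.height k)

instance (k : ℕ) : Finite (S.Square k) := inferInstanceAs (Finite (S.cells k (S.height k)))

variable {S}

/-- The approximate square of level `k` that contains an approximate square of level `k + r`. -/
def Square.up {k : ℕ} (r : ℕ) (p : S.Square (k + r)) : S.Square k :=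
  ⟨S.parent r (S.height (k + r) - S.height k) p.1, parent_mem_cells (S.self_le_height k) (by
    rw [Nat.add_sub_cancel' (S.height_le_height_add k r)]
    exact p.2)⟩

/-- Linkage of approximate squares. -/
def Square.Linked {k : ℕ} (p p' : S.Square k) : Prop :=
  RowSystem.Linked S k (S.height k) p.1 p'.1

variable (S) in
/-- `exists_cell_binning` for approximate squares. -/
theorem exists_square_binning {q : ℕ} (hq : 2 * S.a ^ q < S.n ^ q) :
    ∃ k₀ r : ℕ, q ≤ k₀ ∧ 0 < k₀ ∧ 0 < r ∧ ∀ k ≥ k₀, k < S.height k ∧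
      ∃ M > 0, (∀ μ : S.Square k, Nat.card {ν : S.Square (k + r) // ν.up r = μ} = M) ∧
        ∃ bin : S.Square (k + r) → S.Square k,
          (∀ ν, (bin ν).Linked (ν.up r)) ∧ (∀ ν ν', ν.Linked ν' → bin ν = bin ν') ∧
          ∀ μ, Nat.card {ν // bin ν = μ} = M := by
  obtain ⟨r, hr⟩ := S.exists_cell_binning hq
  refine ⟨max (q + 1) (S.m ^ (r + 2 + 1)), r + 2, by omega, by omega, by omega,
    fun k hk => ?_⟩
  have hkh : k + (r + 2) ≤ S.height k := S.add_le_height ((le_max_right _ _).trans hk)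
  refine ⟨by omega, ?_⟩
  have hd := S.height_add_le (k := k) (by omega) (r + 2)
  obtain ⟨δ, hδ⟩ : ∃ δ, S.height (k + (r + 2)) = S.height k + (δ + 2) :=
    ⟨S.height (k + (r + 2)) - S.height k - 2, by omega⟩
  obtain ⟨bin, h1, h2, h3⟩ := hr k (S.height k) δ (by omega) (by omega) (by omega)
  rw [← hδ] at h1 h2 h3
  have hδ' : S.height (k + (r + 2)) - S.height k = δ + 2 := by omega
  refine ⟨S.a ^ (r + 2) * S.Y.card ^ (δ + 2),
    Nat.mul_pos (pow_pos S.a_pos _) (pow_pos S.Y_nonempty.card_pos _), fun μ => ?_,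
    fun ν => ⟨bin ν.1, (h1 ν.1 ν.2).1⟩, fun ν => ?_,
    fun ν ν' h => Subtype.ext (h2 ν.1 ν.2 ν'.1 ν'.2 h), fun μ => ?_⟩
  · have := card_children (Δ := δ + 2) hkh μ.2
    rw [← hδ] at this
    rw [← this, ← hδ']
    exact natCard_fiber (fun ν : S.Square (k + (r + 2)) => ν.up (r + 2)) (fun _ => rfl) μ
  · have := (h1 ν.1 ν.2).2
    rw [← hδ'] at this
    exact this
  · rw [← h3 μ.1 μ.2]
    exact natCard_fiber (g := bin) (fun ν : S.Square (k + (r + 2)) =>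
      (⟨bin ν.1, (h1 ν.1 ν.2).1⟩ : S.Square k)) (fun _ => rfl) μ

theorem Square.Linked.trans {k : ℕ} {p p' p'' : S.Square k} (h : p.Linked p')
    (h' : p'.Linked p'') : p.Linked p'' := RowSystem.Linked.trans h h'

theorem Square.Linked.symm {k : ℕ} {p p' : S.Square k} (h : p.Linked p') : p'.Linked p :=
  RowSystem.Linked.symm h

/-- The arithmetic progression `k₀, k₀ + r, k₀ + 2 * r, …`. -/
def scale (k₀ r : ℕ) : ℕ → ℕ
  | 0 => k₀
  | i + 1 => scale k₀ r i + r

theorem add_le_scale {k₀ r : ℕ} (hr : 0 < r) (i : ℕ) : i + k₀ ≤ scale k₀ r i := by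
  induction i with
  | zero => exact (Nat.zero_add k₀).le
  | succ i ih => rw [scale]; omega

variable (S) in
/-- Along a suitable progression of levels, every approximate square `ν` of level `i + 1` can be
assigned an approximate square `q i ν` of level `i` so that linked squares are assigned the same
square, squares with unlinked parents are assigned different ones, and the assignments of
consecutive levels are compatible. -/
theorem exists_assignment : ∃ c k₀ r : ℕ, 0 < k₀ ∧ 0 < r ∧
    (∀ k ≥ k₀, ∀ p p' : S.Square k, p.Linked p' → p'.1.1 ≤ p.1.1 + c ∧ p'.1.2 ≤ p.1.2 + c) ∧
    ∃ q : ∀ i, S.Square (scale k₀ r (i + 1)) → S.Square (scale k₀ r i),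
      (∀ i ν ν', ν.Linked ν' → q i ν = q i ν') ∧
      (∀ i ν ν', q i ν = q i ν' → Square.Linked (Square.up r ν) (Square.up r ν')) ∧
      (∀ i, Function.Surjective (q i)) ∧
      ∀ i ν, Square.up r (q (i + 1) ν) = q i (Square.up r ν) := by
  obtain ⟨c, hc⟩ := exists_two_mul_pow_lt_pow S.a_pos S.a_lt_n
  obtain ⟨k₀, r, hck, hk₀, hr, H⟩ := S.exists_square_binning hc
  refine ⟨2 * S.n ^ c + S.m, k₀, r, hk₀, hr, fun k hk p p' h => ?_, ?_⟩
  · have := RowSystem.Linked.bounds hc (hck.trans hk) (H k hk).1 h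
    omega
  have hscale : ∀ i, k₀ ≤ scale k₀ r i := fun i =>
    (Nat.le_add_left k₀ i).trans (add_le_scale hr i)
  choose M hM hup bin hlink hconst hbin using fun i => (H _ (hscale i)).2
  obtain ⟨φ, hφ⟩ := exists_level_equivs (N := fun i => S.Square (scale k₀ r i))
    (fun i => Square.up r) bin M hup hbin
  refine ⟨fun i ν => φ i (bin i ν), fun i ν ν' h => ?_, fun i ν ν' h => ?_, fun i => ?_,
    fun i ν => ?_⟩
  · dsimp only
    rw [hconst i ν ν' h]
  · have h' := (φ i).injective h
    have h1 := hlink i ν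
    rw [h'] at h1
    exact h1.symm.trans (hlink i ν')
  · refine (φ i).surjective.comp fun μ => ?_
    have hpos : 0 < Nat.card {ν // bin i ν = μ} := by rw [hbin]; exact hM i
    obtain ⟨⟨ν, hν⟩⟩ := (Nat.card_pos_iff.1 hpos).1
    exact ⟨ν, hν⟩
  · have h1 := hφ i (bin (i + 1) ν)
    have h2 := hconst i _ _ (hlink (i + 1) ν)
    dsimp only at h1 h2 ⊢
    rw [h1, h2]

end RowSystem

end Carpet

namespace Carpet

/-! ### Approximate squares and distances -/

namespace RowSystem

variable {S : RowSystem} {D : Finset (Fin S.n × Fin S.m)}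

/-- The digit set described by a `RowSystem`. -/
def Describes (S : RowSystem) (D : Finset (Fin S.n × Fin S.m)) : Prop :=
  ∀ d, d ∈ D ↔ (d.2 : ℕ) ∈ S.Y ∧ (d.1 : ℕ) ∈ S.A d.2

theorem prefixNum_mem_cells (hD : S.Describes D) {k L : ℕ} (hk : k ≤ L) (w : DigitSpace D) :
    (prefixNum w.fstSeq k, prefixNum w.sndSeq L) ∈ S.cells k L := by
  have hw := fun p => (hD _).1 (w p).2
  refine mem_cells.2 ⟨prefixNum_mem_digitSet.2 fun p _ => (hw p).1,
    prefixNum_mem_digitSet.2 fun p hp => ?_⟩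
  rw [rowAt, prefixNum_digit w.sndSeq (by omega)]
  exact (hw p).2

/-- The approximate square of level `k` of a sequence of digits. -/
def squareOf (hD : S.Describes D) (k : ℕ) (w : DigitSpace D) : S.Square k :=
  ⟨(prefixNum w.fstSeq k, prefixNum w.sndSeq (S.height k)),
    prefixNum_mem_cells hD (S.self_le_height k) w⟩

theorem squareOf_up (hD : S.Describes D) (k r : ℕ) (w : DigitSpace D) :
    (squareOf hD (k + r) w).up r = squareOf hD k w := by
  refine Subtype.ext (Prod.ext (prefixNum_add_div w.fstSeq k r) ?_)
  have := prefixNum_add_div w.sndSeq (S.height k) (S.height (k + r) - S.height k)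
  rwa [Nat.add_sub_cancel' (S.height_le_height_add k r)] at this

theorem squareOf_eq_iff (hD : S.Describes D) {k : ℕ} {w w' : DigitSpace D} :
    squareOf hD k w = squareOf hD k w' ↔ (∀ p < k, w.fstSeq p = w'.fstSeq p) ∧
      ∀ p < S.height k, w.sndSeq p = w'.sndSeq p := by
  exact Subtype.ext_iff.trans (Prod.ext_iff.trans (and_congr prefixNum_eq_iff prefixNum_eq_iff))

theorem squareOf_surjective (hD : S.Describes D) (k : ℕ) :
    Function.Surjective (squareOf hD k) := by
  rintro ⟨⟨x, v⟩, hp⟩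
  have hk := S.self_le_height k
  have hxv := mem_cells.1 hp
  obtain ⟨u, rfl⟩ := exists_prefixNum_eq S.n_pos (lt_of_mem_digitSet S.n_pos hxv.2)
  obtain ⟨y, rfl⟩ := exists_prefixNum_eq S.m_pos (lt_of_mem_digitSet S.m_pos hxv.1)
  have hy : ∀ p < S.height k, (y p : ℕ) ∈ S.Y := prefixNum_mem_digitSet.1 hxv.1
  have hu : ∀ p < k, (u p : ℕ) ∈ S.A (y p) := by
    intro p hp
    have := prefixNum_mem_digitSet.1 hxv.2 p hp
    rwa [rowAt, prefixNum_digit y (by omega)] at this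
  have hrow : ∀ j ∈ S.Y, ∃ d : D, (d.1.2 : ℕ) = j := by
    intro j hj
    obtain ⟨i, hi⟩ := Finset.card_pos.1 (show 0 < (S.A j).card by rw [S.card_A]; exact S.a_pos)
    exact ⟨⟨(⟨i, lt_n_of_mem_A hi⟩, ⟨j, lt_m_of_mem_Y hj⟩), (hD _).2 ⟨hj, hi⟩⟩, rfl⟩
  have hd : ∀ p, ∃ d : D, (p < k → d.1.1 = u p) ∧ (p < S.height k → d.1.2 = y p) := by
    intro p
    by_cases hpk : p < k
    · exact ⟨⟨(u p, y p), (hD _).2 ⟨hy p (by omega), hu p hpk⟩⟩, fun _ => rfl, fun _ => rfl⟩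
    by_cases hph : p < S.height k
    · obtain ⟨d, hd⟩ := hrow _ (hy p hph)
      exact ⟨d, fun h => absurd h hpk, fun _ => Fin.ext hd⟩
    · obtain ⟨d, -⟩ := hrow _ S.Y_nonempty.choose_spec
      exact ⟨d, fun h => absurd h hpk, fun h => absurd h hph⟩
  choose w hw using hd
  refine ⟨w, Subtype.ext (Prod.ext ?_ ?_)⟩
  · exact prefixNum_eq_iff.2 fun p hp => (hw p).1 hp
  · exact prefixNum_eq_iff.2 fun p hp => (hw p).2 hp

/-- A compatible sequence of approximate squares is the sequence of squares of a point. -/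
theorem exists_squareOf_eq (hD : S.Describes D) {k₀ r : ℕ} (hk₀ : 0 < k₀) (hr : 0 < r)
    (q : ∀ i, S.Square (scale k₀ r i)) (hq : ∀ i, Square.up r (q (i + 1)) = q i) :
    ∃ w : DigitSpace D, ∀ i, squareOf hD (scale k₀ r i) w = q i := by
  choose ω hω using fun i => squareOf_surjective hD (scale k₀ r i) (q i)
  have hagree : ∀ i j, i ≤ j →
      squareOf hD (scale k₀ r i) (ω i) = squareOf hD (scale k₀ r i) (ω j) := by
    intro i j hij
    rw [hω]
    have hdown : ∀ l w, squareOf hD (scale k₀ r (i + l)) w = q (i + l) →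
        squareOf hD (scale k₀ r i) w = q i := by
      intro l
      induction l with
      | zero => exact fun _ h => h
      | succ l ih =>
        intro w h
        refine ih w ?_
        rw [← squareOf_up hD _ r, ← hq]
        exact congrArg (Square.up r) h
    obtain ⟨l, rfl⟩ := Nat.exists_eq_add_of_le hij
    exact (hdown l (ω (i + l)) (hω _)).symm
  have hscale : ∀ p, p < scale k₀ r p := fun p =>
    (Nat.lt_add_of_pos_right hk₀).trans_le (add_le_scale hr p)
  let w : DigitSpace D := fun p => ω p p
  refine ⟨w, fun i => ?_⟩
  rw [← hω i, squareOf_eq_iff]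
  have key : ∀ p, (p < scale k₀ r i → (ω p).fstSeq p = (ω i).fstSeq p) ∧
      (p < S.height (scale k₀ r i) → (ω p).sndSeq p = (ω i).sndSeq p) := by
    intro p
    rcases le_total p i with h | h
    · have := (squareOf_eq_iff hD).1 (hagree p i h)
      exact ⟨fun _ => this.1 p (hscale p),
        fun _ => this.2 p ((hscale p).trans_le (S.self_le_height _))⟩
    · have := (squareOf_eq_iff hD).1 (hagree i p h)
      exact ⟨fun hp => (this.1 p hp).symm, fun hp => (this.2 p hp).symm⟩
  exact ⟨fun p => (key p).1, fun p => (key p).2⟩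

theorem one_le_cast_n : (1 : ℝ) ≤ S.n := by exact_mod_cast S.n_pos

theorem one_le_cast_m : (1 : ℝ) ≤ S.m := by exact_mod_cast S.m_pos

theorem cast_pow_le_pow_height (k : ℕ) : (S.n : ℝ) ^ k ≤ (S.m : ℝ) ^ S.height k := by
  exact_mod_cast S.pow_le_pow_height k

theorem cast_pow_height_le {k : ℕ} (hk : 0 < k) : (S.m : ℝ) ^ S.height k ≤ S.m * S.n ^ k := by
  exact_mod_cast S.pow_height_le hk

theorem pow_mul_dist_le_of_squareOf_eq (hD : S.Describes D) {k : ℕ} {w w' : DigitSpace D}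
    (h : squareOf hD k w = squareOf hD k w') : (S.n : ℝ) ^ k * dist w w' ≤ 1 := by
  have hn := one_le_cast_n (S := S)
  have hm := one_le_cast_m (S := S)
  obtain ⟨h1, h2⟩ := (squareOf_eq_iff hD).1 h
  have hpos : (0 : ℝ) < S.n ^ k := by positivity
  rw [mul_comm, ← le_div_iff₀ hpos]
  refine max_le ?_ ?_
  · refine (prefixDist_le (by positivity) (one_div_natCast_le_one _) h1).trans_eq ?_
    rw [one_div_pow]
  · refine (prefixDist_le (by positivity) (one_div_natCast_le_one _) h2).trans ?_
    rw [one_div_pow]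
    exact one_div_le_one_div_of_le hpos (cast_pow_le_pow_height k)

theorem one_le_pow_mul_dist_of_squareOf_ne (hD : S.Describes D) {k : ℕ} (hk : 0 < k)
    {w w' : DigitSpace D} (h : squareOf hD k w ≠ squareOf hD k w') :
    1 ≤ S.m * ((S.n : ℝ) ^ k * dist w w') := by
  have hn := one_le_cast_n (S := S)
  have hm := one_le_cast_m (S := S)
  have hpos : (0 : ℝ) < S.n ^ k := by positivity
  rw [Ne, squareOf_eq_iff, not_and_or] at h
  rw [← mul_assoc, mul_comm, ← div_le_iff₀ (by positivity)]
  rcases h with h | h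
  · refine le_trans ?_ ((le_prefixDist (by positivity) (one_div_natCast_le_one _) h).trans
      (le_max_left _ _))
    rw [one_div_pow]
    exact one_div_le_one_div_of_le hpos (le_mul_of_one_le_left hpos.le hm)
  · refine le_trans ?_ ((le_prefixDist (by positivity) (one_div_natCast_le_one _) h).trans
      (le_max_right _ _))
    rw [one_div_pow]
    exact one_div_le_one_div_of_le (by positivity) (cast_pow_height_le hk)

theorem abs_apply_sub_le_dist (z z' : Plane) (i : Fin 2) : |z i - z' i| ≤ dist z z' := by
  rw [dist_eq_norm, ← Real.norm_eq_abs]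
  exact PiLp.norm_apply_le (z - z') i

theorem dist_le_abs_add_abs (z z' : Plane) : dist z z' ≤ |z 0 - z' 0| + |z 1 - z' 1| := by
  rw [EuclideanSpace.dist_eq, Fin.sum_univ_two, Real.dist_eq, Real.dist_eq]
  refine Real.sqrt_le_iff.2 ⟨by positivity, ?_⟩
  nlinarith [abs_nonneg (z 0 - z' 0), abs_nonneg (z 1 - z' 1)]

theorem one_le_pow_mul_dist_of_not_linked (hD : S.Describes D) {k : ℕ} (hk : 0 < k)
    {w w' : DigitSpace D} (h : ¬ (squareOf hD k w).Linked (squareOf hD k w')) :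
    1 ≤ S.m * ((S.n : ℝ) ^ k * dist (point w) (point w')) := by
  contrapose! h
  have hn := one_le_cast_n (S := S)
  have hm := one_le_cast_m (S := S)
  have hd : (0 : ℝ) ≤ dist (point w) (point w') := dist_nonneg
  have hpow : (0 : ℝ) ≤ S.n ^ k * dist (point w) (point w') := by positivity
  have h0 : (S.n : ℝ) ^ k * |Real.ofDigits w.fstSeq - Real.ofDigits w'.fstSeq| < 1 :=
    calc _ ≤ (S.n : ℝ) ^ k * dist (point w) (point w') :=
          mul_le_mul_of_nonneg_left (abs_apply_sub_le_dist (point w) (point w') 0) (by positivity)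
      _ < 1 := (le_mul_of_one_le_left hpow hm).trans_lt h
  have h1 : (S.m : ℝ) ^ S.height k * |Real.ofDigits w.sndSeq - Real.ofDigits w'.sndSeq| < 1 :=
    calc _ ≤ (S.m : ℝ) ^ S.height k * dist (point w) (point w') :=
          mul_le_mul_of_nonneg_left (abs_apply_sub_le_dist (point w) (point w') 1) (by positivity)
      _ ≤ S.m * S.n ^ k * dist (point w) (point w') :=
          mul_le_mul_of_nonneg_right (cast_pow_height_le hk) hd
      _ < 1 := by rwa [mul_assoc]
  have h0' := h0
  have h1' := h1
  rw [abs_sub_comm] at h0' h1'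
  exact linked_of_close (squareOf hD k w).2 (squareOf hD k w').2 (prefixNum_le_add_one h0)
    (prefixNum_le_add_one h0') (prefixNum_le_add_one h1) (prefixNum_le_add_one h1')

theorem pow_mul_dist_le_of_close (hD : S.Describes D) {k c : ℕ} {w w' : DigitSpace D}
    (h : (squareOf hD k w').1.1 ≤ (squareOf hD k w).1.1 + c ∧
      (squareOf hD k w').1.2 ≤ (squareOf hD k w).1.2 + c)
    (h' : (squareOf hD k w).1.1 ≤ (squareOf hD k w').1.1 + c ∧
      (squareOf hD k w).1.2 ≤ (squareOf hD k w').1.2 + c) :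
    (S.n : ℝ) ^ k * dist (point w) (point w') ≤ 2 * (c + 1) := by
  have h0 := pow_mul_abs_ofDigits_sub_le h'.1 h.1
  have h1 := pow_mul_abs_ofDigits_sub_le h'.2 h.2
  have hd := mul_le_mul_of_nonneg_left (dist_le_abs_add_abs (point w) (point w'))
    (show (0 : ℝ) ≤ S.n ^ k by positivity)
  have h2 := mul_le_mul_of_nonneg_right (cast_pow_le_pow_height (S := S) k)
    (abs_nonneg (Real.ofDigits w.sndSeq - Real.ofDigits w'.sndSeq))
  have h3 : (S.n : ℝ) ^ k * (|point w 0 - point w' 0| + |point w 1 - point w' 1|) =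
    (S.n : ℝ) ^ k * |Real.ofDigits w.fstSeq - Real.ofDigits w'.fstSeq| +
      (S.n : ℝ) ^ k * |Real.ofDigits w.sndSeq - Real.ofDigits w'.sndSeq| := mul_add _ _ _
  linarith

/-! ### The bi-Lipschitz map -/

/-- Comparison of two distances through a sequence of scales `k₀, k₀ + r, …`, when `d` determines
up to a bounded factor the first scale at which two points are separated, and so does `d'` up to a
bounded shift of scales. -/
theorem comparison_of_scales {k₀ r : ℕ} {b C d d' : ℝ} (hb : 1 < b) (hr : 0 < r) (hC : 1 ≤ C)
    {same : ℕ → Prop} (hd : 0 < d) (hd' : 0 ≤ d') (hd1 : d' ≤ 1)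
    (h₁ : ∀ i, same i → b ^ scale k₀ r i * d ≤ C)
    (h₂ : ∀ i, ¬ same i → 1 ≤ C * (b ^ scale k₀ r i * d))
    (h₃ : ∀ i, same (i + 1) → b ^ scale k₀ r i * d' ≤ C)
    (h₄ : ∀ i, ¬ same i → 1 ≤ C * (b ^ scale k₀ r i * d'))
    (hd0 : d ≤ C) :
    d ≤ (C * C * b ^ (k₀ + r + r)) * d' ∧ d' ≤ (C * C * b ^ (k₀ + r + r)) * d := by
  have hb0 : (0 : ℝ) < b := by linarith
  have hex : ∃ i, ¬ same i := by
    by_contra! hall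
    obtain ⟨i, hi⟩ := pow_unbounded_of_one_lt (C / d) hb
    have h5 := h₁ i (hall i)
    have h6 := mul_le_mul_of_nonneg_right (pow_le_pow_right₀ hb.le
      ((Nat.le_add_right i k₀).trans (add_le_scale hr i))) hd.le
    rw [div_lt_iff₀ hd] at hi
    linarith
  classical
  set i := Nat.find hex with hi
  have hns : ¬ same i := Nat.find_spec hex
  have hs : ∀ j < i, same j := fun j hj => not_not.1 (Nat.find_min hex hj)
  have hpos : (0 : ℝ) < b ^ scale k₀ r i := by positivity
  -- both distances are comparable to `b ^ (-scale k₀ r i)`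
  have hle : ∀ {x y e : ℝ}, 0 ≤ x → x * b ^ scale k₀ r i ≤ C * e → 0 ≤ e →
      e ≤ b ^ (k₀ + r + r) → 1 ≤ C * (b ^ scale k₀ r i * y) →
      x ≤ (C * C * b ^ (k₀ + r + r)) * y := by
    intro x y e hx h5 he h6 h7
    have hy : 0 < b ^ scale k₀ r i * y := by
      by_contra! hy
      nlinarith
    have h8 : C * e ≤ C * e * (C * (b ^ scale k₀ r i * y)) :=
      le_mul_of_one_le_right (by positivity) h7
    have h9 : C * e * (C * (b ^ scale k₀ r i * y)) ≤
        C * b ^ (k₀ + r + r) * (C * (b ^ scale k₀ r i * y)) := by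
      gcongr
    refine le_of_mul_le_mul_right ?_ hpos
    linarith
  have hstep : ∀ j, b ^ scale k₀ r (j + 1) = b ^ scale k₀ r j * b ^ r := fun j => pow_add _ _ _
  have hp : ∀ {p}, p ≤ k₀ + r + r → b ^ p ≤ b ^ (k₀ + r + r) := fun h =>
    pow_le_pow_right₀ hb.le h
  constructor
  · rcases hcase : i with _ | j
    · refine hle hd.le (e := b ^ k₀) ?_ (by positivity) (hp (by omega)) (h₄ i hns)
      rw [hcase]
      exact mul_le_mul_of_nonneg_right hd0 (by positivity)
    · refine hle hd.le (e := b ^ r) ?_ (by positivity) (hp (by omega)) (h₄ i hns)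
      rw [hcase, hstep, ← mul_assoc, mul_comm d]
      exact mul_le_mul_of_nonneg_right (h₁ j (hs j (by omega))) (by positivity)
  -- `d'` is controlled one scale later than `d`
  · rcases hcase : i with _ | _ | j
    · refine hle hd' (e := b ^ k₀) ?_ (by positivity) (hp (by omega)) (h₂ i hns)
      rw [hcase]
      exact mul_le_mul_of_nonneg_right (hd1.trans hC) (by positivity)
    · refine hle hd' (e := b ^ (k₀ + r)) ?_ (by positivity) (hp (by omega)) (h₂ i hns)
      rw [hcase]
      exact mul_le_mul_of_nonneg_right (hd1.trans hC) (by positivity)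
    · refine hle hd' (e := b ^ (r + r)) ?_ (by positivity) (hp (by omega)) (h₂ i hns)
      rw [hcase, hstep, hstep, ← mul_assoc, ← mul_assoc, mul_comm d', mul_assoc, ← pow_add]
      exact mul_le_mul_of_nonneg_right (h₃ j (hs (j + 1) (by omega))) (by positivity)

theorem lipschitzEquivalent_digitSpace (hD : S.Describes D) :
    LipschitzEquivalent (Set.range (point (D := D))) (DigitSpace D) := by
  obtain ⟨c, k₀, r, hk₀, hr, hbd, q, hq1, hq2, hq3, hq4⟩ := S.exists_assignment
  have hn : (1 : ℝ) < S.n := by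
    have h1 := S.two_le_m
    have h2 := S.m_lt_n
    exact_mod_cast (by omega : 1 < S.n)
  have hm := one_le_cast_m (S := S)
  have hscale : ∀ i, k₀ ≤ scale k₀ r i := fun i =>
    (Nat.le_add_left k₀ i).trans (add_le_scale hr i)
  choose code hcode using fun z : Set.range (point (D := D)) => z.2
  let sq : ∀ i, Set.range (point (D := D)) → S.Square (scale k₀ r i) :=
    fun i z => squareOf hD _ (code z)
  have hup : ∀ i z, Square.up r (sq (i + 1) z) = sq i z := fun i z => squareOf_up hD _ r _
  choose f hf using fun z => exists_squareOf_eq hD hk₀ hr (fun i => q i (sq (i + 1) z))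
    (fun i => (hq4 i _).trans (congrArg (q i) (hup (i + 1) z)))
  set C : ℝ := 2 * (c + 1) + S.m with hC
  have hc0 : (0 : ℝ) ≤ c := Nat.cast_nonneg c
  have hCm : (S.m : ℝ) ≤ C := by rw [hC]; linarith
  have hC1 : (1 : ℝ) ≤ C := hm.trans hCm
  have hbig : ∀ {x : ℝ}, 1 ≤ S.m * x → 1 ≤ C * x := by
    intro x hx
    have hx0 : 0 ≤ x := by
      by_contra! h
      nlinarith
    exact hx.trans (mul_le_mul_of_nonneg_right hCm hx0)
  have hbound : ∀ z z', dist z z' ≤ (C * C * S.n ^ (k₀ + r + r)) * dist (f z) (f z') ∧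
      dist (f z) (f z') ≤ (C * C * S.n ^ (k₀ + r + r)) * dist z z' := by
    intro z z'
    rcases eq_or_ne z z' with rfl | hne
    · simp
    have hdist : dist (point (code z)) (point (code z')) = dist z z' := by
      rw [hcode, hcode, Subtype.dist_eq]
    refine comparison_of_scales (same := fun i => (sq i z).Linked (sq i z')) hn hr hC1
      (dist_pos.2 hne) dist_nonneg ?_ (fun i hi => ?_) (fun i hi => ?_) (fun i hi => ?_)
      (fun i hi => ?_) ?_
    · have h := pow_mul_dist_le_of_squareOf_eq hD (k := 0) (w := f z) (w' := f z')
        ((squareOf_eq_iff hD).2 ⟨by simp, by simp [height]⟩)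
      simpa using h
    · rw [← hdist]
      refine (pow_mul_dist_le_of_close hD (c := c) (hbd _ (hscale i) _ _ hi)
        (hbd _ (hscale i) _ _ hi.symm)).trans ?_
      rw [hC]
      linarith
    · rw [← hdist]
      exact hbig (one_le_pow_mul_dist_of_not_linked hD (hk₀.trans_le (hscale i)) hi)
    · refine (pow_mul_dist_le_of_squareOf_eq hD ?_).trans hC1
      rw [hf, hf]
      exact hq1 i _ _ hi
    · refine hbig (one_le_pow_mul_dist_of_squareOf_ne hD (hk₀.trans_le (hscale i)) ?_)
      rw [hf, hf]
      intro h
      have := hq2 i _ _ h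
      rw [hup, hup] at this
      exact hi this
    · have h := pow_mul_dist_le_of_close hD (k := 0) (c := c) (w := code z) (w' := code z')
        (by simp [squareOf, height, prefixNum]) (by simp [squareOf, height, prefixNum])
      rw [hdist] at h
      rw [hC]
      simp only [pow_zero, one_mul] at h
      linarith
  set K : ℝ := C * C * S.n ^ (k₀ + r + r) with hK
  have hKpos : 0 < K := by positivity
  refine ⟨f, ?_, K, hKpos, fun z z' => ⟨?_, (hbound z z').2⟩⟩
  · -- the image of `f` is compact and meets every approximate square
    have hcont : Continuous f :=
      (LipschitzWith.of_dist_le_mul (K := K.toNNReal) fun z z' => by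
        rw [Real.coe_toNNReal _ hKpos.le]; exact (hbound z z').2).continuous
    have : CompactSpace (Set.range (point (D := D))) :=
      isCompact_iff_compactSpace.1 isCompact_range_point
    have hclosed : IsClosed (Set.range f) := (isCompact_range hcont).isClosed
    intro w
    rw [← Set.mem_range, ← hclosed.closure_eq, Metric.mem_closure_range_iff]
    intro ε hε
    obtain ⟨i, hi⟩ := pow_unbounded_of_one_lt (1 / ε) hn
    obtain ⟨ν, hν⟩ := hq3 i (squareOf hD _ w)
    obtain ⟨w', rfl⟩ := squareOf_surjective hD _ ν
    set z : Set.range (point (D := D)) := ⟨point w', w', rfl⟩ with hz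
    have hlink : (sq (i + 1) z).Linked (squareOf hD _ w') := by
      by_contra h
      have := one_le_pow_mul_dist_of_not_linked hD (hk₀.trans_le (hscale (i + 1))) h
      rw [hcode, dist_self, mul_zero, mul_zero] at this
      exact absurd this (by norm_num)
    have hsq : squareOf hD (scale k₀ r i) w = squareOf hD (scale k₀ r i) (f z) := by
      rw [hf, ← hν]
      exact (hq1 i _ _ hlink).symm
    have h1 := pow_mul_dist_le_of_squareOf_eq hD hsq
    have h2 : (S.n : ℝ) ^ i ≤ (S.n : ℝ) ^ scale k₀ r i :=
      pow_le_pow_right₀ hn.le ((Nat.le_add_right i k₀).trans (add_le_scale hr i))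
    refine ⟨z, ?_⟩
    by_contra! h
    rw [div_lt_iff₀ hε] at hi
    have h3 : (S.n : ℝ) ^ i * ε ≤ (S.n : ℝ) ^ scale k₀ r i * dist w (f z) :=
      mul_le_mul h2 h hε.le (by positivity)
    linarith
  · rw [inv_mul_le_iff₀ hKpos]
    exact (hbound z z').1

end RowSystem

end Carpet

theorem theorem1p4 {n m : ℕ} (hm : 2 ≤ m) (hmn : m < n) (D : Finset (Fin n × Fin m))
    (hN : 1 < D.card) (E : Set Carpet.Plane) (hE : Carpet.IsCarpet D E)
    (ht : IsTotallyDisconnected E) (hv : Carpet.HasVacantRow D) (hr : Carpet.HasUniformFibers D) :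
    Carpet.LipschitzEquivalent E (Carpet.DigitSpace D) := by
  have hDne : D.Nonempty := Finset.card_pos.1 (by omega)
  obtain rfl : E = Set.range (Carpet.point (D := D)) :=
    (Carpet.existsUnique_isCarpet hm hmn D hDne).unique hE (Carpet.isCarpet_range_point hDne)
  obtain ⟨S, rfl, rfl, hS⟩ := Carpet.exists_rowSystem hm hmn D hN
    (Carpet.exists_notMem_of_isTotallyDisconnected (by omega) ht) hv hr
  exact Carpet.RowSystem.lipschitzEquivalent_digitSpace hS
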